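/- Let $n\ge 0$ be an integer, let $\eta=\mathrm{diag}(\sigma_0,\dots,\sigma_n)$ with $\sigma_A=\pm1$ be a pseudo-Euclidean metric on $\mathbb R^{n+1}$, write $y^2=\eta(y,y)$, let $\epsilon\in\{1,-1\}$ and $H>0$, and put $$\Sigma_n=\{y\in\mathbb R^{n+1}: y^2=-\epsilon H^{-2}\},\qquad \mathcal C=\{y\in\mathbb R^{n+1}:\operatorname{sgn}(y^2)=-\epsilon\}.$$ ($\eta$ of signature $(1,n)$ and $\epsilon=1$ gives de Sitter space; signature $(2,n-1)$ and $\epsilon=-1$ gives anti-de Sitter space.) Give $\Sigma_n$ the metric induced by $\eta$ and the orientation defined by its outer normal. Let $l:\Sigma_n\to\mathbb R^{n+1}$ be the inclusion, and let $\square_{n+1}$ and $\square_\Sigma$ be the Laplace--de Rham operators $\square=-(d\delta+\delta d)$, $\delta=\ast^{-1}d\ast(-1)^k$ on $k$-forms, of $\mathbb R^{n+1}$ and of $\Sigma_n$. For a smooth one-form $\alpha$ on the open cone $\mathcal C\supset\Sigma_n$, the additional term $\mathrm{AT}(\alpha)$ is the one-form on $\Sigma_n$ determined by $$l^*(\square_{n+1}\alpha)=\square_\Sigma(l^*\alpha)+\mathrm{AT}(\alpha).$$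 For a one-form $h$ on $\Sigma_n$ and $s\in\mathbb R$, let $h^{(s)}$ be the extension of $h$ to $\mathcal C$ that is transverse and homogeneous of degree $s$: for $y\in\mathcal C$ and $v\in\mathbb R^{n+1}$, with $\rho(y)=H\sqrt{|y^2|}$ and $\hat y=y/\rho(y)\in\Sigma_n$, $$h^{(s)}_y(v)=\rho(y)^{\,s-1}\,h_{\hat y}(P_{\hat y}v),$$ where $P_{\hat y}$ is the $\eta$-orthogonal projection of $\mathbb R^{n+1}$ onto $T_{\hat y}\Sigma_n$. Let $\chi:\Omega^1(\Sigma_n)\to\Omega^1(\Sigma_n)$ be an arbitrary map (not necessarily linear) on the smooth one-forms of $\Sigma_n$. Then the equation $s^2+(n-3)s=1$ has a real solution, and for every real solution $s$ the map $$\varpi_\chi(b)=b^{(0)}-\epsilon H^{-2}\left(\chi(b)^{(s)}-\chi(b)^{(0)}\right),\qquad b\in\Omega^1(\Sigma_n),$$ takes values in the smooth one-forms on $\mathcal C$, is a section of $l^*$, i.e. $l^*\varpi_\chi(b)=b$, and satisfies $\mathrm{AT}(\varpi_\chi(b))=\chi(b)$ for all $b\in\Omega^1(\Sigma_n)$. 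-/

import Mathlib

open scoped ContDiff

noncomputable section

/-! ## Hodge star on a finite-dimensional real vector space with a metric and a volume form -/

/-- The bijection `Fin k ⊕ Fin m ≃ Fin d`, `k + m = d`, listing the first block first. -/
def blockEquiv {k m d : ℕ} (h : k + m = d) : Fin k ⊕ Fin m ≃ Fin d :=
  finSumFinEquiv.trans (finCongr h)

theorem sumElim_update_comp {V : Type*} {k m d : ℕ} [DecidableEq (Fin m)] (h : k + m = d)
    (u : Fin k → V) (w : Fin m → V) (i : Fin m) (z : V) :
    Sum.elim u (Function.update w i z) ∘ (blockEquiv h).symm =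
      Function.update (Sum.elim u w ∘ (blockEquiv h).symm) (blockEquiv h (Sum.inr i)) z := by
  funext j
  obtain ⟨j, rfl⟩ := (blockEquiv h).surjective j
  rcases j with j | j
  · rw [Function.update_of_ne ((blockEquiv h).injective.ne Sum.inl_ne_inr)]
    simp only [Function.comp_apply, Equiv.symm_apply_apply, Sum.elim_inl]
  · by_cases hj : j = i
    · subst hj
      simp only [Function.comp_apply, Equiv.symm_apply_apply, Sum.elim_inr, Function.update_self]
    · rw [Function.update_of_ne ((blockEquiv h).injective.ne (Sum.inr_injective.ne hj))]
      simp only [Function.comp_apply, Equiv.symm_apply_apply, Sum.elim_inr,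
        Function.update_of_ne hj]

/-- The alternating map `w ↦ vol (u₁, …, uₖ, w₁, …, wₘ)`, i.e. `i_{uₖ} ⋯ i_{u₁} vol`. -/
def contract {V : Type*} [NormedAddCommGroup V] [NormedSpace ℝ V] {k m d : ℕ} (h : k + m = d)
    (vol : V [⋀^Fin d]→L[ℝ] ℝ) (u : Fin k → V) : V [⋀^Fin m]→L[ℝ] ℝ where
  toFun w := vol (Sum.elim u w ∘ (blockEquiv h).symm)
  map_update_add' w i x y := by
    simp only [sumElim_update_comp, ContinuousAlternatingMap.map_update_add]
  map_update_smul' w i c x := by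
    simp only [sumElim_update_comp, ContinuousAlternatingMap.map_update_smul]
  map_eq_zero_of_eq' w i j hw hij := by
    refine vol.map_eq_zero_of_eq _ (i := blockEquiv h (Sum.inr i))
      (j := blockEquiv h (Sum.inr j)) ?_ ?_
    · simpa using hw
    · simpa using hij
  cont := by
    refine vol.cont.comp (continuous_pi fun j => ?_)
    simp only [Function.comp_apply]
    rcases (blockEquiv h).symm j with a | a
    · exact continuous_const
    · exact continuous_apply a

/-- The Gram matrix `g_{ij} = g(f_i, f_j)`. -/
def gram {V ι : Type*} [NormedAddCommGroup V] [NormedSpace ℝ V] [Fintype ι] [DecidableEq ι]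
    (g : LinearMap.BilinForm ℝ V) (f : Module.Basis ι ℝ V) : Matrix ι ι ℝ :=
  Matrix.of fun i j => g (f i) (f j)

/-- `sgn(g)`, the sign of the determinant of the metric `g`. -/
def sgnMetric {V ι : Type*} [NormedAddCommGroup V] [NormedSpace ℝ V] [Fintype ι] [DecidableEq ι]
    (g : LinearMap.BilinForm ℝ V) (f : Module.Basis ι ℝ V) : ℝ :=
  Real.sign (gram g f).det

/-- The Hodge star `⋆ : Λᵏ → Λᵐ`, `k + m = d`, of a metric `g` with volume form `vol`:
`(⋆α)(w) = (1/k!) g^{a₁b₁} ⋯ g^{aₖbₖ} α(f_{a₁}, …, f_{aₖ}) vol(f_{b₁}, …, f_{bₖ}, w)`,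
computed in a basis `f` (the result does not depend on `f`).  It is characterised by
`β ∧ ⋆α = (β, α)_g vol`. -/
def hodgeStar {V ι : Type*} [NormedAddCommGroup V] [NormedSpace ℝ V] [Fintype ι] [DecidableEq ι]
    (g : LinearMap.BilinForm ℝ V) (f : Module.Basis ι ℝ V) {k m d : ℕ} (h : k + m = d)
    (vol : V [⋀^Fin d]→L[ℝ] ℝ) (α : V [⋀^Fin k]→L[ℝ] ℝ) : V [⋀^Fin m]→L[ℝ] ℝ :=
  ((k.factorial : ℝ)⁻¹) • ∑ a : Fin k → ι, ∑ b : Fin k → ι,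
    ((∏ l, (gram g f)⁻¹ (a l) (b l)) * α (fun l => f (a l))) • contract h vol (fun l => f (b l))

/-- The inverse Hodge star on `q`-forms, `⋆⁻¹ = sgn(g) (-1)^{q(d+1)} ⋆`. -/
def hodgeStarInv {V ι : Type*} [NormedAddCommGroup V] [NormedSpace ℝ V] [Fintype ι]
    [DecidableEq ι] (g : LinearMap.BilinForm ℝ V) (f : Module.Basis ι ℝ V) {q m d : ℕ}
    (h : q + m = d) (vol : V [⋀^Fin d]→L[ℝ] ℝ) (α : V [⋀^Fin q]→L[ℝ] ℝ) :
    V [⋀^Fin m]→L[ℝ] ℝ :=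
  (sgnMetric g f * (-1) ^ (q * (d + 1))) • hodgeStar g f h vol α

/-! ## The ambient pseudo-Euclidean space and the pseudo-sphere -/

/-- The data `(η, ε, H)`: a diagonal metric `η = diag(σ₀, …, σₙ)` with `σ_A = ± 1` on `ℝⁿ⁺¹`,
a sign `ε = ± 1` and a constant `H > 0`.  De Sitter space is `σ = (1, -1, …, -1)`, `ε = 1`;
anti-de Sitter space is `σ = (1, -1, …, -1, 1)`, `ε = -1`; the Euclidean sphere is
`σ = (1, …, 1)`, `ε = -1`. -/
structure PseudoSphereData (n : ℕ) where
  σ : Fin (n + 1) → ℝ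
  ε : ℝ
  H : ℝ
  σ_eq : ∀ A, σ A = 1 ∨ σ A = -1
  ε_eq : ε = 1 ∨ ε = -1
  H_pos : 0 < H

namespace PseudoSphereData

variable {n : ℕ} (S : PseudoSphereData n)

/-- The metric `η(u, v) = ∑_A σ_A u^A v^A` on `ℝⁿ⁺¹`. -/
def η : LinearMap.BilinForm ℝ (Fin (n + 1) → ℝ) := Matrix.toBilin' (Matrix.diagonal S.σ)

/-- The pseudo-sphere `Σₙ = {y | η(y, y) = -ε H⁻²}`. -/
def sphere : Set (Fin (n + 1) → ℝ) := {y | S.η y y = -S.ε * (S.H ^ 2)⁻¹}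

/-- The open cone `{y | sgn η(y, y) = -ε}` over `Σₙ`. -/
def cone : Set (Fin (n + 1) → ℝ) := {y | Real.sign (S.η y y) = -S.ε}

/-- The tangent space `T_pΣₙ = {v | η(p, v) = 0}`. -/
def tangent (p : S.sphere) : Submodule ℝ (Fin (n + 1) → ℝ) := LinearMap.ker (S.η p)

/-- `H √|η(y, y)|`, which equals `1` on `Σₙ`. -/
def radius (y : Fin (n + 1) → ℝ) : ℝ := S.H * √|S.η y y|

theorem sphere_self_ne_zero (p : S.sphere) : S.η p p ≠ 0 := by
  have h : S.η p p = -S.ε * (S.H ^ 2)⁻¹ := p.2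
  have hH := S.H_pos
  rw [h]
  rcases S.ε_eq with e | e <;> rw [e] <;> simp [hH.ne']

theorem radial_mem {y : Fin (n + 1) → ℝ} (hy : y ∈ S.cone) : (S.radius y)⁻¹ • y ∈ S.sphere := by
  have hH := S.H_pos
  have hs : Real.sign (S.η y y) = -S.ε := hy
  have h0 : S.η y y ≠ 0 := by
    intro h0
    rw [h0, Real.sign_zero] at hs
    rcases S.ε_eq with e | e <;> rw [e] at hs <;> norm_num at hs
  have ha : |S.η y y| ≠ 0 := abs_ne_zero.mpr h0
  have key : S.η y y = -S.ε * |S.η y y| := by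
    rw [← hs]
    rcases lt_or_gt_of_ne h0 with h | h
    · rw [Real.sign_of_neg h, abs_of_neg h]; ring
    · rw [Real.sign_of_pos h, abs_of_pos h]; ring
  have hr : (S.radius y)⁻¹ * ((S.radius y)⁻¹ * S.η y y) = (S.H ^ 2)⁻¹ * |S.η y y|⁻¹ * S.η y y := by
    rw [← mul_assoc, ← mul_inv, radius, ← mul_inv]
    congr 2
    rw [mul_mul_mul_comm, Real.mul_self_sqrt (abs_nonneg _), sq]
  change S.η ((S.radius y)⁻¹ • y) ((S.radius y)⁻¹ • y) = _
  simp only [map_smul, LinearMap.smul_apply, smul_eq_mul]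
  rw [hr, key, abs_mul, abs_abs]
  have he : |-S.ε| = 1 := by rcases S.ε_eq with e | e <;> rw [e] <;> simp
  rw [he]
  field_simp

/-- The radial projection `y ↦ y / (H √|η(y, y)|)` of the cone onto `Σₙ`. -/
def radial (y : Fin (n + 1) → ℝ) (hy : y ∈ S.cone) : S.sphere :=
  ⟨(S.radius y)⁻¹ • y, S.radial_mem hy⟩

/-- The `η`-orthogonal projection `v ↦ v - η(p, v) / η(p, p) p` of `ℝⁿ⁺¹` onto `T_pΣₙ`. -/
def tangentProj (p : S.sphere) : (Fin (n + 1) → ℝ) →L[ℝ] S.tangent p :=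
  LinearMap.toContinuousLinearMap <|
    LinearMap.codRestrict (S.tangent p)
      (LinearMap.id - ((S.η p p)⁻¹ • S.η p).smulRight (p : Fin (n + 1) → ℝ))
      (fun v => by
        have := S.sphere_self_ne_zero p
        simp [tangent, field])

/-! ## Differential forms -/

/-- A (not necessarily smooth) field of `k`-forms on `Σₙ`. -/
def SphereForm (k : ℕ) : Type := ∀ p : S.sphere, S.tangent p [⋀^Fin k]→L[ℝ] ℝ

/-- The restriction `l^*α` to `Σₙ` of a form `α` on (an open subset of) `ℝⁿ⁺¹`, where
`l : Σₙ → ℝⁿ⁺¹` is the inclusion. -/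
def restr {k : ℕ} (α : (Fin (n + 1) → ℝ) → (Fin (n + 1) → ℝ) [⋀^Fin k]→L[ℝ] ℝ) :
    S.SphereForm k :=
  fun p => (α p).compContinuousLinearMap (S.tangent p).subtypeL

/-- The extension `β^{(s)}` of a `k`-form `β` on `Σₙ` to the cone that is transverse
(`i_D β^{(s)} = 0`) and homogeneous of degree `s`.  Its components in the frame obtained by moving
an adapted frame along the half-lines from the origin, equivalently its Cartesian components, are
homogeneous of degree `s - k`.  Outside of the cone, the value `0` is irrelevant. -/
def ext {k : ℕ} (s : ℝ) (β : S.SphereForm k) :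
    (Fin (n + 1) → ℝ) → (Fin (n + 1) → ℝ) [⋀^Fin k]→L[ℝ] ℝ := by
  classical
  exact fun y => if hy : y ∈ S.cone then
    (S.radius y) ^ (s - k) •
      (β (S.radial y hy)).compContinuousLinearMap (S.tangentProj (S.radial y hy))
  else 0

/-- A form on `Σₙ` is smooth if its pullback `β^{(0)}` under the radial projection is smooth
on the cone (equivalently: if it is locally the restriction of a smooth form on `ℝⁿ⁺¹`). -/
def IsSmooth {k : ℕ} (β : S.SphereForm k) : Prop := ContDiffOn ℝ ∞ (S.ext 0 β) S.cone

/-- Smooth one-forms on `Σₙ`. -/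
def OneForm : Type := {b : S.SphereForm 1 // S.IsSmooth b}

/-- The exterior derivative on `Σₙ`: `dβ = l^* d(β^{(0)})`, where `β^{(0)}` is the pullback of `β`
under the radial projection.  Any other differentiable extension of `β` gives the same result. -/
def sphereD {k : ℕ} (β : S.SphereForm k) : S.SphereForm (k + 1) :=
  S.restr (extDeriv (S.ext 0 β))

/-! ## Codifferential and Laplace-de Rham operator of `ℝⁿ⁺¹` -/

/-- The volume form `dy⁰ ∧ ⋯ ∧ dyⁿ` of `ℝⁿ⁺¹`. -/
def ambientVol : (Fin (n + 1) → ℝ) [⋀^Fin (n + 1)]→L[ℝ] ℝ :=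
  { (Pi.basisFun ℝ (Fin (n + 1))).det with
    cont := by
      change Continuous fun v => (Pi.basisFun ℝ (Fin (n + 1))).det v
      simp only [Pi.basisFun_det_apply]
      exact Continuous.matrix_det continuous_id }

/-- The codifferential `δ = ⋆⁻¹ d ⋆ (-1)^{k+1}` on `(k+1)`-forms of `ℝⁿ⁺¹`
(zero if `k + 1 > n + 1`, since then there are no nonzero `(k+1)`-forms). -/
def ambientDelta {k : ℕ}
    (α : (Fin (n + 1) → ℝ) → (Fin (n + 1) → ℝ) [⋀^Fin (k + 1)]→L[ℝ] ℝ) :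
    (Fin (n + 1) → ℝ) → (Fin (n + 1) → ℝ) [⋀^Fin k]→L[ℝ] ℝ :=
  if h : k + 1 ≤ n + 1 then fun y =>
    hodgeStarInv S.η (Pi.basisFun ℝ (Fin (n + 1))) (q := n + 1 - (k + 1) + 1) (by omega) ambientVol
      (extDeriv (fun z => hodgeStar S.η (Pi.basisFun ℝ (Fin (n + 1)))
        (m := n + 1 - (k + 1)) (by omega) ambientVol ((-1 : ℝ) ^ (k + 1) • α z)) y)
  else 0

/-- The Laplace-de Rham operator `□ = -(dδ + δd)` of `ℝⁿ⁺¹`, on forms of positive degree. -/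
def ambientBox {k : ℕ}
    (α : (Fin (n + 1) → ℝ) → (Fin (n + 1) → ℝ) [⋀^Fin (k + 1)]→L[ℝ] ℝ) :
    (Fin (n + 1) → ℝ) → (Fin (n + 1) → ℝ) [⋀^Fin (k + 1)]→L[ℝ] ℝ :=
  fun y => -(extDeriv (S.ambientDelta α) y + S.ambientDelta (extDeriv α) y)

/-! ## Codifferential and Laplace-de Rham operator of `Σₙ` -/

/-- The metric induced by `η` on `T_pΣₙ`. -/
def sphereMetric (p : S.sphere) : LinearMap.BilinForm ℝ (S.tangent p) :=
  S.η.restrict (S.tangent p)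

/-- The volume form of `Σₙ` oriented by its outer unit normal `N = H p`:
`vol_p(w₁, …, wₙ) = (dy⁰ ∧ ⋯ ∧ dyⁿ)(w₁, …, wₙ, N)`. -/
def sphereVol (p : S.sphere) : S.tangent p [⋀^Fin n]→L[ℝ] ℝ :=
  (-1 : ℝ) ^ n •
    (contract (k := 1) (Nat.add_comm 1 n) ambientVol
      (fun _ => S.H • (p : Fin (n + 1) → ℝ))).compContinuousLinearMap (S.tangent p).subtypeL

/-- The codifferential `δ = ⋆⁻¹ d ⋆ (-1)^{k+1}` on `(k+1)`-forms of `Σₙ`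
(zero if `k + 1 > n`, since then there are no nonzero `(k+1)`-forms). -/
def sphereDelta {k : ℕ} (β : S.SphereForm (k + 1)) : S.SphereForm k :=
  if h : k + 1 ≤ n then fun p =>
    hodgeStarInv (S.sphereMetric p) (Module.finBasis ℝ (S.tangent p)) (q := n - (k + 1) + 1)
      (by omega) (S.sphereVol p)
      (S.sphereD (fun q => hodgeStar (S.sphereMetric q) (Module.finBasis ℝ (S.tangent q))
        (m := n - (k + 1)) (by omega) (S.sphereVol q) ((-1 : ℝ) ^ (k + 1) • β q)) p)
  else fun _ => 0

/-- The Laplace-de Rham operator `□ = -(dδ + δd)` of `Σₙ`, on forms of positive degree. -/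
def sphereBox {k : ℕ} (β : S.SphereForm (k + 1)) : S.SphereForm (k + 1) :=
  fun p => -(S.sphereD (S.sphereDelta β) p + S.sphereDelta (S.sphereD β) p)

/-! ## Additional term and section -/

/-- The additional term `AT(α)`, defined by `l^*(□α) = □_Σ(l^*α) + AT(α)`. -/
def additionalTerm {k : ℕ}
    (α : (Fin (n + 1) → ℝ) → (Fin (n + 1) → ℝ) [⋀^Fin (k + 1)]→L[ℝ] ℝ) : S.SphereForm (k + 1) :=
  fun p => S.restr (S.ambientBox α) p - S.sphereBox (S.restr α) p

/-- `ϖ_χ(b) = b^{(0)} - ε H⁻² (χ(b)^{(s)} - χ(b)^{(0)})`. -/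
def varpi (s : ℝ) (χ : S.OneForm → S.OneForm) (b : S.OneForm) :
    (Fin (n + 1) → ℝ) → (Fin (n + 1) → ℝ) [⋀^Fin 1]→L[ℝ] ℝ :=
  fun y => S.ext 0 b.1 y - (S.ε * (S.H ^ 2)⁻¹) • (S.ext s (χ b).1 y - S.ext 0 (χ b).1 y)

end PseudoSphereData

end

noncomputable section

/-! ## Tuples and block decompositions -/

/-! On one-forms of flat space the symmetry of second derivatives reduces $-(d\delta+\delta d)$ to
the componentwise Laplacian $\sum_A\sigma_A\partial_A\partial_A$ (`ambientBox_apply`). The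
additional term is then controlled by two facts.

First, $\mathrm{AT}(b^{(0)})=0$ (`IsSmooth.sphereBox_apply`). The form $b^{(0)}$ is the pullback of
$b$ under the radial projection, so both $b^{(0)}$ and $db^{(0)}$ are annihilated by the position
field $D$, and $d$ on $\Sigma_n$ is the restriction of $d$ on the cone. The codifferentials are
traces of a flat derivative, over $T_p\Sigma_n$ and over $\mathbb R^{n+1}$ respectively; these
traces differ by $\eta(p,p)^{-1}$ times the entry on $(p,p)$ (`sum_basisFun_eq_tangent_add`), which
Euler's relation and transversality make zero.

Writing $\delta_\Sigma$ as such a trace is the laborious part. Algebraically, $\star^{-1}d\star$ is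
a contraction by Cramer's rule: alternating $d+1$ vectors in dimension $d$ gives zero. Analytically,
the star of $\Sigma_n$ is a multiple of the ambient star contracted with the position vector
(`StarRelation`). Differentiating the position vector contributes only an ambient star of a
transverse form on tangent vectors, which vanishes; hence no connection terms appear
(`sphereD_sphereStar`).

Second, $b^{(s)}=\rho^s b^{(0)}$, and the Leibniz rule with Euler's relation gives on $\Sigma_n$ the
identity $\square b^{(s)}=\square b^{(0)}-\epsilon H^2(s^2+(n-3)s)\,b^{(0)}$
(`IsSmooth.ambientBox_ext`). Since $b^{(s)}$ and $b^{(0)}$ restrict to the same form, $-\epsilon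
H^{-2}(\chi(b)^{(s)}-\chi(b)^{(0)})$ restricts to zero and adds $(s^2+(n-3)s)\chi(b)=\chi(b)$ to the
additional term. For each $b$ the form $\chi(b)$ enters as a fixed form, so nothing is asked of the
map $\chi$. -/

theorem Fin.removeNth_succ_cons {V : Type*} {m : ℕ} (i : Fin (m + 1)) (x : V)
    (v : Fin (m + 1) → V) :
    (i.succ.removeNth (Fin.cons x v : Fin (m + 2) → V) : Fin (m + 1) → V) =
      Fin.cons x (i.removeNth v) := by
  funext j
  cases j using Fin.cases with
  | zero => simp [Fin.removeNth]
  | succ j => simp [Fin.removeNth, Fin.succ_succAbove_succ]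

theorem sumElim_comp_blockEquiv_symm_eq {V : Type*} {k m d : ℕ} (h : k + m = d)
    (u : Fin k → V) (w : Fin m → V) (x : Fin d → V)
    (hl : ∀ i, x (blockEquiv h (Sum.inl i)) = u i) (hr : ∀ i, x (blockEquiv h (Sum.inr i)) = w i) :
    Sum.elim u w ∘ (blockEquiv h).symm = x := by
  funext j
  obtain ⟨j, rfl⟩ := (blockEquiv h).surjective j
  rcases j with j | j
  · simp [hl]
  · simp [hr]

theorem sumElim_comp_blockEquiv_symm_one {V : Type*} {m : ℕ} (h : 1 + m = m + 1)
    (u : Fin 1 → V) (w : Fin m → V) :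
    Sum.elim u w ∘ (blockEquiv h).symm = Fin.cons (u 0) w := by
  apply sumElim_comp_blockEquiv_symm_eq
  · intro i
    have : blockEquiv h (Sum.inl i) = 0 := by
      ext; simp [blockEquiv]
    rw [this, Fin.cons_zero, Subsingleton.elim i 0]
  · intro i
    have : blockEquiv h (Sum.inr i) = i.succ := by
      ext; simp [blockEquiv]
    rw [this, Fin.cons_succ]

theorem sumElim_comp_blockEquiv_symm_two {V : Type*} {m : ℕ} (h : 2 + m = m + 2)
    (u : Fin 2 → V) (w : Fin m → V) :
    Sum.elim u w ∘ (blockEquiv h).symm = Fin.cons (u 0) (Fin.cons (u 1) w) := by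
  apply sumElim_comp_blockEquiv_symm_eq
  · intro i
    fin_cases i
    · have : blockEquiv h (Sum.inl 0) = 0 := by
        ext; simp [blockEquiv]
      simp [this]
    · have : blockEquiv h (Sum.inl 1) = Fin.succ 0 := by
        ext; simp [blockEquiv]
      simp only [Fin.mk_one]
      rw [this, Fin.cons_succ, Fin.cons_zero]
  · intro i
    have : blockEquiv h (Sum.inr i) = i.succ.succ := by
      ext; simp [blockEquiv]
    rw [this, Fin.cons_succ, Fin.cons_succ]

theorem sumElim_comp_blockEquiv_symm_last {V : Type*} {m : ℕ} (h : m + 1 = m + 1)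
    (u : Fin m → V) (w : Fin 1 → V) :
    Sum.elim u w ∘ (blockEquiv h).symm = Fin.snoc u (w 0) := by
  apply sumElim_comp_blockEquiv_symm_eq
  · intro i
    have : blockEquiv h (Sum.inl i) = i.castSucc := by
      ext; simp [blockEquiv]
    rw [this, Fin.snoc_castSucc]
  · intro i
    have : blockEquiv h (Sum.inr i) = Fin.last m := by
      ext; simp [blockEquiv]
    rw [this, Fin.snoc_last, Subsingleton.elim i 0]

theorem sumElim_comp_blockEquiv_symm_zero {V : Type*} {m : ℕ} (h : m + 0 = m)
    (u : Fin m → V) (w : Fin 0 → V) :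
    Sum.elim u w ∘ (blockEquiv h).symm = u := by
  apply sumElim_comp_blockEquiv_symm_eq
  · intro i
    congr 1
  · intro i
    exact i.elim0

/-! ## The dual basis and the Hodge star -/

section Algebra

variable {V ι : Type*} [NormedAddCommGroup V] [NormedSpace ℝ V] [Fintype ι] [DecidableEq ι]

/-- The `g`-dual basis `f^c = g^{cb} f_b`. -/
def dualVec (g : LinearMap.BilinForm ℝ V) (f : Module.Basis ι ℝ V) (c : ι) : V :=
  ∑ b, (gram g f)⁻¹ c b • f b

/-- Multilinearity of `vol` in its first block absorbs the inverse Gram matrices into the dual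
vectors, so that later computations contract only basis and dual basis. -/
theorem hodgeStar_apply (g : LinearMap.BilinForm ℝ V) (f : Module.Basis ι ℝ V) {k m d : ℕ}
    (h : k + m = d) (vol : V [⋀^Fin d]→L[ℝ] ℝ) (α : V [⋀^Fin k]→L[ℝ] ℝ) (w : Fin m → V) :
    hodgeStar g f h vol α w = (k.factorial : ℝ)⁻¹ * ∑ a : Fin k → ι, α (fun l => f (a l)) *
      vol (Sum.elim (fun l => dualVec g f (a l)) w ∘ (blockEquiv h).symm) := by
  have key : ∀ a : Fin k → ι,
      vol (Sum.elim (fun l => dualVec g f (a l)) w ∘ (blockEquiv h).symm) =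
        ∑ b : Fin k → ι, (∏ l, (gram g f)⁻¹ (a l) (b l)) *
          vol (Sum.elim (fun l => f (b l)) w ∘ (blockEquiv h).symm) := by
    intro a
    -- Currying over the two blocks makes `vol` multilinear in the first block alone, where the sums
    -- defining the dual vectors can be expanded.
    let M := (vol.toMultilinearMap.domDomCongr (blockEquiv h).symm).currySum
    have hM : ∀ u : Fin k → V, M u w = vol (Sum.elim u w ∘ (blockEquiv h).symm) := fun u => rfl
    rw [← hM]
    simp_rw [← hM]
    change M (fun l => ∑ b, (gram g f)⁻¹ (a l) b • f b) w = _
    rw [MultilinearMap.map_sum, sum_apply]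
    refine Finset.sum_congr rfl fun b _ => ?_
    rw [MultilinearMap.map_smul_univ]
    rfl
  simp only [hodgeStar, ContinuousAlternatingMap.smul_apply, ContinuousAlternatingMap.sum_apply,
    smul_eq_mul]
  congr 1
  refine Finset.sum_congr rfl fun a _ => ?_
  rw [key, Finset.mul_sum]
  refine Finset.sum_congr rfl fun b _ => ?_
  change _ * vol (Sum.elim (fun l => f (b l)) w ∘ (blockEquiv h).symm) = _
  ring

theorem hodgeStar_one_apply (g : LinearMap.BilinForm ℝ V) (f : Module.Basis ι ℝ V) {m : ℕ}
    (h : 1 + m = m + 1) (vol : V [⋀^Fin (m + 1)]→L[ℝ] ℝ) (α : V [⋀^Fin 1]→L[ℝ] ℝ)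
    (w : Fin m → V) :
    hodgeStar g f h vol α w =
      ∑ c, α (fun _ => f c) * vol (Fin.cons (dualVec g f c) w) := by
  rw [hodgeStar_apply, ← (Equiv.funUnique (Fin 1) ι).symm.sum_comp]
  simp only [Nat.factorial_one, Nat.cast_one, inv_one, one_mul, sumElim_comp_blockEquiv_symm_one]
  rfl

theorem hodgeStar_two_apply (g : LinearMap.BilinForm ℝ V) (f : Module.Basis ι ℝ V) {m : ℕ}
    (h : 2 + m = m + 2) (vol : V [⋀^Fin (m + 2)]→L[ℝ] ℝ) (α : V [⋀^Fin 2]→L[ℝ] ℝ)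
    (w : Fin m → V) :
    hodgeStar g f h vol α w = 2⁻¹ * ∑ c, ∑ c', α ![f c, f c'] *
      vol (Fin.cons (dualVec g f c) (Fin.cons (dualVec g f c') w)) := by
  rw [hodgeStar_apply, ← (finTwoArrowEquiv ι).symm.sum_comp, Fintype.sum_prod_type]
  simp only [Nat.factorial_two, Nat.cast_ofNat, sumElim_comp_blockEquiv_symm_two]
  congr 1
  refine Finset.sum_congr rfl fun c _ => Finset.sum_congr rfl fun c' _ => ?_
  congr 2
  funext l
  fin_cases l <;> rfl

/-- The sign is the cost of moving the single free argument from the last slot to the first. -/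
theorem hodgeStar_codim_one_apply (g : LinearMap.BilinForm ℝ V) (f : Module.Basis ι ℝ V) {m : ℕ}
    (h : m + 1 = m + 1) (vol : V [⋀^Fin (m + 1)]→L[ℝ] ℝ) (α : V [⋀^Fin m]→L[ℝ] ℝ)
    (w : Fin 1 → V) :
    hodgeStar g f h vol α w = (m.factorial : ℝ)⁻¹ * ∑ a : Fin m → ι, α (fun l => f (a l)) *
      ((-1) ^ m * vol (Fin.cons (w 0) fun l => dualVec g f (a l))) := by
  rw [hodgeStar_apply]
  congr 1
  refine Finset.sum_congr rfl fun a _ => ?_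
  rw [sumElim_comp_blockEquiv_symm_last, ← Fin.insertNth_last', vol.map_insertNth]
  simp [Matrix.vecCons]

theorem hodgeStar_top_apply (g : LinearMap.BilinForm ℝ V) (f : Module.Basis ι ℝ V) {m : ℕ}
    (h : m + 0 = m) (vol : V [⋀^Fin m]→L[ℝ] ℝ) (α : V [⋀^Fin m]→L[ℝ] ℝ)
    (w : Fin 0 → V) :
    hodgeStar g f h vol α w = (m.factorial : ℝ)⁻¹ * ∑ a : Fin m → ι, α (fun l => f (a l)) *
      vol fun l => dualVec g f (a l) := by
  rw [hodgeStar_apply]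
  simp only [sumElim_comp_blockEquiv_symm_zero]

theorem hodgeStar_smul (g : LinearMap.BilinForm ℝ V) (f : Module.Basis ι ℝ V) {k m d : ℕ}
    (h : k + m = d) (vol : V [⋀^Fin d]→L[ℝ] ℝ) (r : ℝ) (α : V [⋀^Fin k]→L[ℝ] ℝ) :
    hodgeStar g f h vol (r • α) = r • hodgeStar g f h vol α := by
  ext w
  simp only [hodgeStar_apply, ContinuousAlternatingMap.smul_apply, smul_eq_mul, Finset.mul_sum]
  exact Finset.sum_congr rfl fun a _ => by ring

/-- The Hodge star as a continuous linear map. -/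
def hodgeStarCLM (g : LinearMap.BilinForm ℝ V) (f : Module.Basis ι ℝ V) {k m d : ℕ}
    (h : k + m = d) (vol : V [⋀^Fin d]→L[ℝ] ℝ) :
    (V [⋀^Fin k]→L[ℝ] ℝ) →L[ℝ] V [⋀^Fin m]→L[ℝ] ℝ :=
  ((k.factorial : ℝ)⁻¹) • ∑ a : Fin k → ι, ∑ b : Fin k → ι,
    (∏ l, (gram g f)⁻¹ (a l) (b l)) •
      (ContinuousAlternatingMap.apply ℝ V ℝ (fun l => f (a l))).smulRight
        (contract h vol (fun l => f (b l)))

theorem hodgeStarCLM_apply (g : LinearMap.BilinForm ℝ V) (f : Module.Basis ι ℝ V) {k m d : ℕ}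
    (h : k + m = d) (vol : V [⋀^Fin d]→L[ℝ] ℝ) (α : V [⋀^Fin k]→L[ℝ] ℝ) :
    hodgeStarCLM g f h vol α = hodgeStar g f h vol α := by
  simp [hodgeStarCLM, hodgeStar, mul_smul]

/-! ### Dual bases and contractions -/

theorem apply_dualVec (g : LinearMap.BilinForm ℝ V) (f : Module.Basis ι ℝ V)
    (hdet : (gram g f).det ≠ 0) (c a : ι) :
    g (dualVec g f c) (f a) = if c = a then 1 else 0 := by
  have h := congrFun (congrFun (Matrix.nonsing_inv_mul (gram g f) hdet.isUnit) c) a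
  rw [Matrix.one_apply] at h
  rw [← h, Matrix.mul_apply]
  simp [dualVec, gram]

theorem sum_apply_dualVec_smul (g : LinearMap.BilinForm ℝ V) (hg : ∀ u v, g u v = g v u)
    (f : Module.Basis ι ℝ V) (hdet : (gram g f).det ≠ 0) (v : V) :
    ∑ c, g v (dualVec g f c) • f c = v := by
  have : ∑ c, (g.flip (dualVec g f c)).smulRight (f c) = LinearMap.id := by
    refine f.ext fun a => ?_
    simp only [LinearMap.sum_apply, LinearMap.smulRight_apply, LinearMap.id_apply]
    simp [hg (f a), apply_dualVec g f hdet]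
  simpa using congrArg (fun T => T v) this

/-- Both sides contract `T` with the inverse Gram matrix, which is symmetric because `g` is. -/
theorem sum_swap_dualVec (g : LinearMap.BilinForm ℝ V) (hg : ∀ u v, g u v = g v u)
    (f : Module.Basis ι ℝ V) (T : V →ₗ[ℝ] V →ₗ[ℝ] ℝ) :
    ∑ c, T (dualVec g f c) (f c) = ∑ c, T (f c) (dualVec g f c) := by
  have hs : ((gram g f)⁻¹).IsSymm := by
    rw [Matrix.IsSymm, Matrix.transpose_nonsing_inv]
    congr 1
    ext i j
    simp [gram, hg (f i)]
  simp only [dualVec, map_sum, LinearMap.sum_apply, map_smul, LinearMap.smul_apply]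
  rw [Finset.sum_comm]
  refine Finset.sum_congr rfl fun c _ => Finset.sum_congr rfl fun b _ => ?_
  rw [hs.apply]

/-- The bilinear map `(u, v) ↦ L u v` of a linear family of one-forms. -/
def bilinOfOneForms (L : V →L[ℝ] V [⋀^Fin 1]→L[ℝ] ℝ) : V →ₗ[ℝ] V →ₗ[ℝ] ℝ :=
  LinearMap.mk₂ ℝ (fun u v => L u (fun _ => v)) (by simp) (by simp)
    (fun u v v' => ((ContinuousAlternatingMap.ofSubsingleton ℝ V ℝ (0 : Fin 1)).symm
      (L u)).map_add v v')
    (fun r u v => ((ContinuousAlternatingMap.ofSubsingleton ℝ V ℝ (0 : Fin 1)).symm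
      (L u)).map_smul r v)

/-- The bilinear map `(u, v) ↦ L u (v, w)` of a linear family of two-forms. -/
def bilinOfTwoForms (L : V →L[ℝ] V [⋀^Fin 2]→L[ℝ] ℝ) (w : V) : V →ₗ[ℝ] V →ₗ[ℝ] ℝ :=
  LinearMap.mk₂ ℝ (fun u v => L u ![v, w]) (by simp) (by simp)
    (fun u v v' => congrArg (fun F => F ![w]) ((L u).curryLeft.map_add v v'))
    (fun r u v => congrArg (fun F => F ![w]) ((L u).curryLeft.map_smul r v))

/-! ### Alternation, Cramer's rule and the inverse star -/

theorem alternatizeUncurryFin_apply_real {d : ℕ} (M : V →L[ℝ] V [⋀^Fin d]→L[ℝ] ℝ)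
    (v : Fin (d + 1) → V) :
    ContinuousAlternatingMap.alternatizeUncurryFin M v =
      ∑ i : Fin (d + 1), (-1 : ℝ) ^ (i : ℕ) * M (v i) (i.removeNth v) := by
  simp [ContinuousAlternatingMap.alternatizeUncurryFin_apply]

/-- The sum is the alternation of $\varphi\otimes\mathrm{vol}$, a form of degree $d+1$ in dimension
$d$. This is Cramer's rule, the engine of all the star identities below. -/
theorem sum_neg_one_pow_mul_removeNth_eq_zero [FiniteDimensional ℝ V] {d : ℕ}
    (hd : Module.finrank ℝ V = d)
    (vol : V [⋀^Fin d]→L[ℝ] ℝ) (φ : V →L[ℝ] ℝ) (v : Fin (d + 1) → V) :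
    ∑ j : Fin (d + 1), (-1) ^ (j : ℕ) * (φ (v j) * vol (j.removeNth v)) = 0 := by
  have h := (ContinuousAlternatingMap.alternatizeUncurryFin
    (φ.smulRight vol)).toAlternatingMap.map_linearDependent v (by
      intro hv
      have := hv.fintype_card_le_finrank
      simp [hd] at this)
  have h' : ContinuousAlternatingMap.alternatizeUncurryFin (φ.smulRight vol) v = 0 := h
  rw [alternatizeUncurryFin_apply_real] at h'
  simpa using h'

/-- The dual basis has the inverse Gram matrix as its coordinate matrix, and `vol` is a multiple of
the determinant. -/
theorem vol_dualVec (g : LinearMap.BilinForm ℝ V)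
    (f : Module.Basis ι ℝ V) {d : ℕ} (e : Fin d ≃ ι) (vol : V [⋀^Fin d]→L[ℝ] ℝ) :
    vol (fun l => dualVec g f (e l)) = (gram g f).det⁻¹ * vol (fun l => f (e l)) := by
  have h := congrArg (fun A => A (fun l => dualVec g f (e l)))
    (vol.toAlternatingMap.eq_smul_basis_det (f.reindex e.symm))
  have h' : vol (fun l => dualVec g f (e l)) = vol (f.reindex e.symm) *
    (f.reindex e.symm).det (fun l => dualVec g f (e l)) := h
  rw [h', Module.Basis.det_apply]
  have : (f.reindex e.symm).toMatrix (fun l => dualVec g f (e l)) =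
      (((gram g f)⁻¹).submatrix e e).transpose := by
    ext i j
    simp [Module.Basis.toMatrix_apply, dualVec, Finsupp.single_apply, Equiv.symm_apply_eq]
  rw [this, Matrix.det_transpose, Matrix.det_submatrix_equiv_self, Matrix.det_nonsing_inv,
    Ring.inverse_eq_inv', mul_comm]
  congr 2
  funext l
  simp

/-- Only injective index tuples, that is permutations, contribute. The two permutation signs
multiply to one, so each of the $d!$ terms is $\mathrm{vol}(f)^2/\det g=\operatorname{sgn}(g)$. -/
theorem sum_vol_mul_vol_dualVec (g : LinearMap.BilinForm ℝ V)
    (f : Module.Basis ι ℝ V) {d : ℕ} (e : Fin d ≃ ι) (vol : V [⋀^Fin d]→L[ℝ] ℝ)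
    (hvol : vol (fun l => f (e l)) ^ 2 = |(gram g f).det|) :
    ∑ a : Fin d → ι, vol (fun l => f (a l)) * vol (fun l => dualVec g f (a l)) =
      d.factorial * sgnMetric g f := by
  have hperm : ∀ σ : Equiv.Perm (Fin d), vol (fun l => f (e (σ l))) *
      vol (fun l => dualVec g f (e (σ l))) = sgnMetric g f := by
    intro σ
    have h1 : vol (fun l => f (e (σ l))) = (Equiv.Perm.sign σ : ℤ) • vol (fun l => f (e l)) :=
      vol.toAlternatingMap.map_perm (fun l => f (e l)) σ
    have h2 : vol (fun l => dualVec g f (e (σ l))) =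
        (Equiv.Perm.sign σ : ℤ) • vol (fun l => dualVec g f (e l)) :=
      vol.toAlternatingMap.map_perm (fun l => dualVec g f (e l)) σ
    have h3 : ((Equiv.Perm.sign σ : ℤ) : ℝ) * (Equiv.Perm.sign σ : ℤ) = 1 := by
      exact_mod_cast Int.units_coe_mul_self _
    rw [h1, h2, vol_dualVec g, sgnMetric, zsmul_eq_mul, zsmul_eq_mul]
    calc _ = (((Equiv.Perm.sign σ : ℤ) : ℝ) * (Equiv.Perm.sign σ : ℤ)) *
          ((gram g f).det⁻¹ * vol (fun l => f (e l)) ^ 2) := by ring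
      _ = _ := by
        rw [h3, hvol, one_mul]
        rcases lt_trichotomy (gram g f).det 0 with h | h | h
        · rw [Real.sign_of_neg h, abs_of_neg h, mul_neg, inv_mul_cancel₀ h.ne]
        · simp [h]
        · rw [Real.sign_of_pos h, abs_of_pos h, inv_mul_cancel₀ h.ne']
  have himg : ∑ a : Fin d → ι, vol (fun l => f (a l)) * vol (fun l => dualVec g f (a l)) =
      ∑ σ : Equiv.Perm (Fin d), vol (fun l => f (e (σ l))) *
        vol (fun l => dualVec g f (e (σ l))) := by
    symm
    refine Finset.sum_of_injOn (fun σ l => e (σ l)) ?_ (by simp) ?_ (by simp)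
    · intro σ _ τ _ h
      refine Equiv.ext fun l => ?_
      simpa using congrFun h l
    · intro a _ ha
      have hinj : ¬ Function.Injective a := by
        intro hinj
        apply ha
        have hb : Function.Bijective (e.symm ∘ a) :=
          Finite.injective_iff_bijective.1 (e.symm.injective.comp hinj)
        exact ⟨Equiv.ofBijective _ hb, by simp, by funext l; simp⟩
      simp only [Function.Injective, not_forall] at hinj
      obtain ⟨i, j, hij, hne⟩ := hinj
      rw [vol.map_eq_zero_of_eq (fun l => f (a l)) (i := i) (j := j) (by simp [hij]) hne,
        zero_mul]
  rw [himg, Finset.sum_congr rfl fun σ _ => hperm σ]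
  simp [Fintype.card_perm]

theorem sgnMetric_mul_self (g : LinearMap.BilinForm ℝ V) (f : Module.Basis ι ℝ V)
    (hdet : (gram g f).det ≠ 0) : sgnMetric g f * sgnMetric g f = 1 := by
  rw [sgnMetric]
  rcases lt_or_gt_of_ne hdet with h | h
  · rw [Real.sign_of_neg h]; norm_num
  · rw [Real.sign_of_pos h]; norm_num

/-- `⋆⁻¹ vol = 1`. -/
theorem hodgeStarInv_smul_vol (g : LinearMap.BilinForm ℝ V)
    (f : Module.Basis ι ℝ V) (hdet : (gram g f).det ≠ 0) {d : ℕ} (e : Fin d ≃ ι)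
    (vol : V [⋀^Fin d]→L[ℝ] ℝ) (hvol : vol (fun l => f (e l)) ^ 2 = |(gram g f).det|)
    (h : d + 0 = d) (r : ℝ) (w : Fin 0 → V) :
    hodgeStarInv g f h vol (r • vol) w = r := by
  rw [hodgeStarInv, ContinuousAlternatingMap.smul_apply, hodgeStar_top_apply]
  simp only [ContinuousAlternatingMap.smul_apply, smul_eq_mul, mul_assoc, ← Finset.mul_sum]
  rw [sum_vol_mul_vol_dualVec g f e vol hvol, (Nat.even_mul_succ_self d).neg_one_pow]
  have := sgnMetric_mul_self g f hdet
  have hf : (d.factorial : ℝ) ≠ 0 := by positivity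
  field_simp
  linear_combination r * this

/-- `⋆⁻¹ ⋆ = 1` on one-forms. -/
theorem hodgeStarInv_hodgeStar_one [FiniteDimensional ℝ V] (g : LinearMap.BilinForm ℝ V)
    (hg : ∀ u v, g u v = g v u)
    (f : Module.Basis ι ℝ V) (hdet : (gram g f).det ≠ 0) {q : ℕ} (e : Fin (q + 1) ≃ ι)
    (vol : V [⋀^Fin (q + 1)]→L[ℝ] ℝ) (hvol : vol (fun l => f (e l)) ^ 2 = |(gram g f).det|)
    (h : 1 + q = q + 1) (h' : q + 1 = q + 1) (δ : V [⋀^Fin 1]→L[ℝ] ℝ) :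
    hodgeStarInv g f h' vol (hodgeStar g f h vol δ) = δ := by
  have hd : Module.finrank ℝ V = q + 1 := by
    rw [Module.finrank_eq_card_basis f, ← Fintype.card_congr e, Fintype.card_fin]
  let φ : V →L[ℝ] ℝ := (ContinuousAlternatingMap.ofSubsingleton ℝ V ℝ (0 : Fin 1)).symm δ
  have hφ : ∀ v : V, δ (fun _ => v) = φ v := fun v => rfl
  ext w
  -- Up to sign and $1/q!$, `A` is the double star of `δ` on `w`. Cramer's rule evaluates it in
  -- terms of `φ (w 0)`.
  set A : ℝ := ∑ a : Fin q → ι, ∑ c, φ (dualVec g f c) *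
    (vol (Fin.cons (f c) fun l => f (a l)) * vol (Fin.cons (w 0) fun l => dualVec g f (a l)))
    with hA
  clear_value A
  have hswap : ∀ a : Fin q → ι, ∑ c, φ (f c) * vol (Fin.cons (dualVec g f c) fun l => f (a l)) =
      ∑ c, φ (dualVec g f c) * vol (Fin.cons (f c) fun l => f (a l)) := by
    intro a
    let ψ : V →ₗ[ℝ] ℝ := (ContinuousAlternatingMap.apply ℝ V ℝ (fun l => f (a l))).toLinearMap ∘ₗ
      vol.curryLeft.toLinearMap
    have := sum_swap_dualVec g hg f ((LinearMap.mul ℝ ℝ).compl₁₂ φ.toLinearMap ψ)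
    exact this.symm
  have cramer : ∀ a : Fin (q + 1) → ι, φ (w 0) * vol (fun l => dualVec g f (a l)) =
      ∑ i : Fin (q + 1), (-1) ^ (i : ℕ) * (φ (dualVec g f (a i)) *
        vol (Fin.cons (w 0) (i.removeNth fun l => dualVec g f (a l)))) := by
    intro a
    have := sum_neg_one_pow_mul_removeNth_eq_zero hd vol φ
      (Fin.cons (w 0) fun l => dualVec g f (a l))
    rw [Fin.sum_univ_succ] at this
    simp only [Fin.removeNth_succ_cons, Fin.removeNth_zero, Fin.tail_cons, Fin.cons_zero,
      Fin.cons_succ, Fin.val_zero, pow_zero, one_mul, Fin.val_succ, pow_succ, mul_neg, mul_one,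
      neg_mul, Finset.sum_neg_distrib] at this
    linarith
  have main : (q + 1 : ℝ) * A = φ (w 0) * ((q + 1).factorial * sgnMetric g f) := by
    rw [← sum_vol_mul_vol_dualVec g f e vol hvol, Finset.mul_sum]
    have : ∀ a : Fin (q + 1) → ι, φ (w 0) * (vol (fun l => f (a l)) *
        vol (fun l => dualVec g f (a l))) = ∑ i : Fin (q + 1), (-1) ^ (i : ℕ) *
          (φ (dualVec g f (a i)) * (vol (fun l => f (a l)) *
          vol (Fin.cons (w 0) (i.removeNth fun l => dualVec g f (a l))))) := by
      intro a
      rw [mul_left_comm, cramer, Finset.mul_sum]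
      exact Finset.sum_congr rfl fun i _ => by ring
    rw [Finset.sum_congr rfl fun a _ => this a]
    rw [Finset.sum_comm]
    -- Moving `f c` from slot `i` to the front costs $(-1)^i$, which cancels the sign of the
    -- expansion. So all $q+1$ slots contribute the same `A`, and dividing by $q+1$ turns $(q+1)!$
    -- into $q!$.
    have each : ∀ i : Fin (q + 1), ∑ a : Fin (q + 1) → ι, (-1) ^ (i : ℕ) *
          (φ (dualVec g f (a i)) * (vol (fun l => f (a l)) *
          vol (Fin.cons (w 0) (i.removeNth fun l => dualVec g f (a l))))) = A := by
      intro i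
      rw [← (Fin.insertNthEquiv (fun _ => ι) i).sum_comp, Fintype.sum_prod_type, hA,
        Finset.sum_comm]
      refine Finset.sum_congr rfl fun a _ => Finset.sum_congr rfl fun c _ => ?_
      simp only [Fin.insertNthEquiv_apply, Fin.insertNth_apply_same]
      have h1 : (fun l => f ((i.insertNth c a : Fin (q + 1) → ι) l)) =
          (i.insertNth (f c) (fun l => f (a l)) : Fin (q + 1) → V) := by
        funext l
        cases l using i.succAboveCases <;> simp
      have h2 : (i.removeNth fun l => dualVec g f ((i.insertNth c a : Fin (q + 1) → ι) l)) =
          fun l => dualVec g f (a l) := by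
        funext l
        simp [Fin.removeNth]
      rw [h1, h2, vol.map_insertNth, zsmul_eq_mul, Int.cast_pow, Int.cast_neg, Int.cast_one]
      have hs : ((-1 : ℝ) ^ (i : ℕ)) * (-1) ^ (i : ℕ) = 1 := by
        rw [← mul_pow]; norm_num
      change _ = φ (dualVec g f c) * (vol (Matrix.vecCons (f c) fun l => f (a l)) * _)
      linear_combination (φ (dualVec g f c) * (vol (Matrix.vecCons (f c) fun l => f (a l)) *
        vol (Fin.cons (w 0) fun l => dualVec g f (a l)))) * hs
    rw [Finset.sum_congr rfl fun i _ => each i]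
    simp
  have hstar : hodgeStar g f h' vol (hodgeStar g f h vol δ) w =
      (q.factorial : ℝ)⁻¹ * ((-1) ^ q * A) := by
    rw [hodgeStar_codim_one_apply]
    congr 1
    rw [hA, Finset.mul_sum]
    refine Finset.sum_congr rfl fun a _ => ?_
    rw [hodgeStar_one_apply]
    simp only [hφ]
    rw [hswap, Finset.sum_mul, Finset.mul_sum]
    exact Finset.sum_congr rfl fun c _ => by ring
  have hA' : A = φ (w 0) * (q.factorial * sgnMetric g f) := by
    rw [Nat.factorial_succ] at main
    push_cast at main
    have : (q + 1 : ℝ) ≠ 0 := by positivity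
    apply mul_left_cancel₀ this
    linear_combination main
  have hw : δ w = φ (w 0) := by
    rw [← hφ]
    congr 1
    funext i
    rw [Subsingleton.elim i 0]
  rw [hodgeStarInv, ContinuousAlternatingMap.smul_apply, hstar, hA', hw, smul_eq_mul]
  have h2 := sgnMetric_mul_self g f hdet
  -- The sign built into $\star^{-1}$ against the sign of the codimension-one star: the total
  -- exponent is $q(q+1)+2q$, which is even.
  have h3 : ((-1 : ℝ) ^ (q * (q + 1 + 1))) * (-1) ^ q = 1 := by
    rw [← pow_add]
    apply Even.neg_one_pow
    have := Nat.even_mul_succ_self q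
    rw [show q * (q + 1 + 1) + q = q * (q + 1) + 2 * q by ring]
    exact this.add (even_two_mul q)
  have hf : (q.factorial : ℝ) ≠ 0 := by positivity
  field_simp
  linear_combination (φ (w 0)) * ((-1 : ℝ) ^ (q * (q + 1 + 1))) * (-1) ^ q * h2 + φ (w 0) * h3

/-- The algebraic part of `⋆⁻¹ d ⋆` on one-forms. -/
theorem hodgeStarInv_alternatize_hodgeStar_one [FiniteDimensional ℝ V]
    (g : LinearMap.BilinForm ℝ V) (hg : ∀ u v, g u v = g v u) (f : Module.Basis ι ℝ V)
    (hdet : (gram g f).det ≠ 0) {m d : ℕ} (e : Fin d ≃ ι) (vol : V [⋀^Fin d]→L[ℝ] ℝ)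
    (hvol : vol (fun l => f (e l)) ^ 2 = |(gram g f).det|)
    (h : 1 + m = d) (h' : (m + 1) + 0 = d) (L : V →L[ℝ] V [⋀^Fin 1]→L[ℝ] ℝ)
    (M : V →L[ℝ] V [⋀^Fin m]→L[ℝ] ℝ) (hM : ∀ u, M u = hodgeStar g f h vol (L u)) (w : Fin 0 → V) :
    hodgeStarInv g f h' vol (ContinuousAlternatingMap.alternatizeUncurryFin M) w =
      ∑ c, L (f c) (fun _ => dualVec g f c) := by
  obtain rfl : d = m + 1 := by omega
  have hd : Module.finrank ℝ V = m + 1 := by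
    rw [Module.finrank_eq_card_basis f, ← Fintype.card_congr e, Fintype.card_fin]
  -- Divergence times volume: for each `c`, Cramer's rule for the functional $u\mapsto L_u(f_c)$ and
  -- the vectors $f^c,v_0,\dots,v_m$ trades the sum over the $v_i$ for
  -- $L_{f^c}(f_c)\,\mathrm{vol}(v)$.
  have key : ContinuousAlternatingMap.alternatizeUncurryFin M =
      (∑ c, L (f c) (fun _ => dualVec g f c)) • vol := by
    have hT : ∑ c, L (dualVec g f c) (fun _ => f c) = ∑ c, L (f c) (fun _ => dualVec g f c) :=
      sum_swap_dualVec g hg f (bilinOfOneForms L)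
    ext v
    rw [alternatizeUncurryFin_apply_real, ← hT,
      ContinuousAlternatingMap.smul_apply, smul_eq_mul, Finset.sum_mul]
    simp only [hM, hodgeStar_one_apply, Finset.mul_sum]
    rw [Finset.sum_comm]
    refine Finset.sum_congr rfl fun c _ => ?_
    have := sum_neg_one_pow_mul_removeNth_eq_zero hd vol
      ((ContinuousAlternatingMap.apply ℝ V ℝ (fun _ => f c)).comp L)
      (Fin.cons (dualVec g f c) v)
    rw [Fin.sum_univ_succ] at this
    simp only [Fin.removeNth_succ_cons, Fin.removeNth_zero, Fin.tail_cons, Fin.cons_zero,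
      Fin.cons_succ, Fin.val_zero, pow_zero, one_mul, Fin.val_succ, pow_succ, mul_neg, mul_one,
      neg_mul, Finset.sum_neg_distrib, ContinuousLinearMap.comp_apply,
      ContinuousAlternatingMap.apply_apply] at this
    linarith
  rw [key, hodgeStarInv_smul_vol g f hdet e vol hvol]

/-- The algebraic part of `⋆⁻¹ d ⋆` on two-forms. -/
theorem hodgeStarInv_alternatize_hodgeStar_two [FiniteDimensional ℝ V]
    (g : LinearMap.BilinForm ℝ V) (hg : ∀ u v, g u v = g v u) (f : Module.Basis ι ℝ V)
    (hdet : (gram g f).det ≠ 0) {m d : ℕ} (e : Fin d ≃ ι) (vol : V [⋀^Fin d]→L[ℝ] ℝ)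
    (hvol : vol (fun l => f (e l)) ^ 2 = |(gram g f).det|)
    (h : 2 + m = d) (h' : (m + 1) + 1 = d) (L : V →L[ℝ] V [⋀^Fin 2]→L[ℝ] ℝ)
    (M : V →L[ℝ] V [⋀^Fin m]→L[ℝ] ℝ) (hM : ∀ u, M u = hodgeStar g f h vol (L u)) (w : Fin 1 → V) :
    hodgeStarInv g f h' vol (ContinuousAlternatingMap.alternatizeUncurryFin M) w =
      -∑ c, L (f c) ![dualVec g f c, w 0] := by
  subst h'
  have hd : Module.finrank ℝ V = m + 2 := by
    rw [Module.finrank_eq_card_basis f, ← Fintype.card_congr e, Fintype.card_fin]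
  -- The alternation of $\star L$ will be $\star$ of this contraction, after which
  -- $\star^{-1}\star=1$ on one-forms finishes.
  let δ : V [⋀^Fin 1]→L[ℝ] ℝ := -∑ c, (L (dualVec g f c)).curryLeft (f c)
  have hδ : ∀ v, δ (fun _ => v) = -∑ c, L (dualVec g f c) ![f c, v] := by
    intro v
    simp only [δ, ContinuousAlternatingMap.neg_apply, ContinuousAlternatingMap.sum_apply,
      ContinuousAlternatingMap.curryLeft_apply_apply]
    congr 1
    refine Finset.sum_congr rfl fun c _ => ?_
    congr 1
    funext i
    fin_cases i <;> rfl
  have key : ContinuousAlternatingMap.alternatizeUncurryFin M =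
      hodgeStar g f (by omega) vol δ := by
    ext v
    rw [alternatizeUncurryFin_apply_real, hodgeStar_one_apply]
    simp only [hM, hodgeStar_two_apply, hδ]
    -- Cramer's rule for $f^c,f^{c'},v_0,\dots,v_m$, which are $m+3$ vectors in dimension $m+2$.
    -- Summed over `c` and `c'`, the two remaining terms agree by antisymmetry of `L u`, which
    -- cancels the factor $1/2$ of the star.
    have each : ∀ c c', ∑ i : Fin (m + 1), (-1) ^ (i : ℕ) * (L (v i) ![f c, f c'] *
        vol (Fin.cons (dualVec g f c) (Fin.cons (dualVec g f c') (i.removeNth v)))) =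
        -(L (dualVec g f c) ![f c, f c'] * vol (Fin.cons (dualVec g f c') v)) +
          L (dualVec g f c') ![f c, f c'] * vol (Fin.cons (dualVec g f c) v) := by
      intro c c'
      have := sum_neg_one_pow_mul_removeNth_eq_zero hd vol
        ((ContinuousAlternatingMap.apply ℝ V ℝ ![f c, f c']).comp L)
        (Fin.cons (dualVec g f c) (Fin.cons (dualVec g f c') v))
      rw [Fin.sum_univ_succ, Fin.sum_univ_succ] at this
      simp only [Fin.removeNth_succ_cons, Fin.removeNth_zero, Fin.tail_cons, Fin.cons_zero,
        Fin.cons_succ, Fin.val_zero, pow_zero, one_mul, Fin.val_succ, pow_succ, mul_neg, mul_one,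
        neg_mul, ContinuousLinearMap.comp_apply,
        ContinuousAlternatingMap.apply_apply, neg_neg] at this
      linarith
    have anti : ∀ u c c', L u ![f c, f c'] = - L u ![f c', f c] := by
      intro u c c'
      have h1 := (L u).toAlternatingMap.map_swap ![f c', f c] (i := 0) (j := 1) (by decide)
      have h2 : ![f c', f c] ∘ (Equiv.swap (0 : Fin 2) 1) = ![f c, f c'] := by
        funext i
        fin_cases i <;> simp
      rw [h2] at h1
      exact h1
    calc _ = 2⁻¹ * ∑ c, ∑ c', ∑ i : Fin (m + 1), (-1) ^ (i : ℕ) * (L (v i) ![f c, f c'] *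
        vol (Fin.cons (dualVec g f c) (Fin.cons (dualVec g f c') (i.removeNth v)))) := by
          simp only [Finset.mul_sum]
          rw [Finset.sum_comm]
          refine Finset.sum_congr rfl fun c _ => ?_
          rw [Finset.sum_comm]
          exact Finset.sum_congr rfl fun c' _ => Finset.sum_congr rfl fun i _ => by ring
      _ = 2⁻¹ * (-∑ c, ∑ c', L (dualVec g f c) ![f c, f c'] * vol (Fin.cons (dualVec g f c') v) +
          ∑ c, ∑ c', L (dualVec g f c') ![f c, f c'] * vol (Fin.cons (dualVec g f c) v)) := by
          simp only [each, Finset.sum_add_distrib, Finset.sum_neg_distrib]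
      _ = -∑ c, ∑ c', L (dualVec g f c) ![f c, f c'] * vol (Fin.cons (dualVec g f c') v) := by
          have : ∑ c, ∑ c', L (dualVec g f c') ![f c, f c'] * vol (Fin.cons (dualVec g f c) v) =
            -∑ c, ∑ c', L (dualVec g f c) ![f c, f c'] * vol (Fin.cons (dualVec g f c') v) := by
            rw [Finset.sum_comm]
            simp only [← Finset.sum_neg_distrib]
            refine Finset.sum_congr rfl fun c _ => Finset.sum_congr rfl fun c' _ => ?_
            rw [anti]
            ring
          rw [this]
          ring
      _ = _ := by
          rw [Finset.sum_comm]
          simp only [neg_mul, Finset.sum_mul, Finset.sum_neg_distrib]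
  rw [key, hodgeStarInv_hodgeStar_one g hg f hdet e vol hvol]
  have hw : w = fun _ => w 0 := by
    funext i
    rw [Subsingleton.elim i 0]
  rw [hw, hδ]
  congr 1
  exact sum_swap_dualVec g hg f (bilinOfTwoForms L (w 0))

end Algebra

end

noncomputable section

/-! ## Alternating maps: auxiliary facts -/

theorem ContinuousAlternatingMap.map_cons_cons_swap {V : Type*} [NormedAddCommGroup V]
    [NormedSpace ℝ V] {m : ℕ} (A : V [⋀^Fin (m + 2)]→L[ℝ] ℝ) (x y : V) (w : Fin m → V) :
    A (Fin.cons x (Fin.cons y w)) = -A (Fin.cons y (Fin.cons x w)) := by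
  have h1 := A.toAlternatingMap.map_swap (Fin.cons y (Fin.cons x w)) (i := 0) (j := 1) (by simp)
  have h2 : (Fin.cons y (Fin.cons x w) : Fin (m + 2) → V) ∘ Equiv.swap (0 : Fin (m + 2)) 1 =
      Fin.cons x (Fin.cons y w) := by
    funext i
    cases i using Fin.cases with
    | zero =>
      simp only [Function.comp_apply, Equiv.swap_apply_left, Fin.cons_zero]
      rfl
    | succ i =>
      cases i using Fin.cases with
      | zero =>
        have : Equiv.swap (0 : Fin (m + 2)) 1 (Fin.succ 0) = 0 := Equiv.swap_apply_right _ _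
        simp only [Function.comp_apply, this, Fin.cons_zero, Fin.cons_succ]
      | succ i =>
        have : Equiv.swap (0 : Fin (m + 2)) 1 i.succ.succ = i.succ.succ :=
          Equiv.swap_apply_of_ne_of_ne (Fin.succ_ne_zero _)
            (fun h => Fin.succ_ne_zero i (Fin.succ_injective _ h))
        simp only [Function.comp_apply, this, Fin.cons_succ]
  rw [h2] at h1
  exact h1

theorem ContinuousAlternatingMap.map_cons_cons_self {V : Type*} [NormedAddCommGroup V]
    [NormedSpace ℝ V] {m : ℕ} (A : V [⋀^Fin (m + 2)]→L[ℝ] ℝ) (x : V) (w : Fin m → V) :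
    A (Fin.cons x (Fin.cons x w)) = 0 := by
  have := A.map_cons_cons_swap x x w
  linarith

/-- A form annihilated by `p` does not see changes of its arguments along `p`. -/
theorem ContinuousAlternatingMap.map_add_smul_of_annihilates {V : Type*} [NormedAddCommGroup V]
    [NormedSpace ℝ V] {m : ℕ} (A : V [⋀^Fin m]→L[ℝ] ℝ) (p : V)
    (hA : ∀ w i, A (Function.update w i p) = 0) (w : Fin m → V) (c : Fin m → ℝ) :
    A (fun i => w i + c i • p) = A w := by
  classical
  have : ∀ s : Finset (Fin m), A (s.piecewise (fun i => w i + c i • p) w) = A w := by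
    intro s
    induction s using Finset.induction_on with
    | empty => simp
    | insert j s hj ih =>
      rw [Finset.piecewise_insert, A.map_update_add, A.map_update_smul, hA, smul_zero, add_zero]
      rw [← ih]
      congr 1
      rw [Function.update_eq_self_iff, Finset.piecewise_eq_of_notMem _ _ _ hj]
  simpa using this Finset.univ

theorem ContinuousAlternatingMap.update_eq_zero_of_curryLeft_eq_zero {V : Type*}
    [NormedAddCommGroup V] [NormedSpace ℝ V] {m : ℕ} (A : V [⋀^Fin (m + 1)]→L[ℝ] ℝ) (p : V)
    (hA : A.curryLeft p = 0) (w : Fin (m + 1) → V) (i : Fin (m + 1)) :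
    A (Function.update w i p) = 0 := by
  rw [← Fin.insertNth_removeNth, A.map_insertNth]
  have : A (Matrix.vecCons p (i.removeNth w)) = 0 := congrArg (fun F => F (i.removeNth w)) hA
  rw [this, smul_zero]

/-- Each of the $m+1$ terms equals `A v` once `v i` is moved back to its slot. In
`sphereD_sphereStar` this sum arises from differentiating the position vector. -/
theorem alternatizeUncurryFin_curryLeft_sum {V : Type*} [NormedAddCommGroup V]
    [NormedSpace ℝ V] {m : ℕ} (A : V [⋀^Fin (m + 1)]→L[ℝ] ℝ) (v : Fin (m + 1) → V) :
    ∑ i : Fin (m + 1), (-1 : ℝ) ^ (i : ℕ) * A (Fin.cons (v i) (i.removeNth v)) =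
      (m + 1) * A v := by
  have h := congrArg (fun F => F v) A.alternatizeUncurryFin_curryLeft
  simp only [alternatizeUncurryFin_apply_real] at h
  rw [ContinuousAlternatingMap.smul_apply, nsmul_eq_mul] at h
  push_cast at h
  exact h

namespace PseudoSphereData

variable {n : ℕ} (S : PseudoSphereData n)

/-! ## The metric of the ambient space -/

theorem η_apply (u v : Fin (n + 1) → ℝ) : S.η u v = ∑ A, S.σ A * (u A * v A) := by
  simp only [η, Matrix.toBilin'_apply', Matrix.mulVec_diagonal, dotProduct]
  exact Finset.sum_congr rfl fun A _ => by ring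

theorem η_comm (u v : Fin (n + 1) → ℝ) : S.η u v = S.η v u := by
  simp only [η_apply]
  exact Finset.sum_congr rfl fun A _ => by ring

theorem σ_mul_self (A : Fin (n + 1)) : S.σ A * S.σ A = 1 := by
  rcases S.σ_eq A with h | h <;> rw [h] <;> norm_num

theorem ε_mul_self : S.ε * S.ε = 1 := by
  rcases S.ε_eq with h | h <;> rw [h] <;> norm_num

theorem gram_basisFun : gram S.η (Pi.basisFun ℝ (Fin (n + 1))) = Matrix.diagonal S.σ := by
  ext i j
  by_cases h : i = j
  · subst h
    simp [gram, η_apply, Pi.single_apply]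
  · simp [gram, η_apply, Pi.single_apply, h, Ne.symm h]

theorem prod_σ_mul_self : (∏ A, S.σ A) * ∏ A, S.σ A = 1 := by
  rw [← Finset.prod_mul_distrib]
  exact Finset.prod_eq_one fun A _ => S.σ_mul_self A

theorem abs_prod_σ : |∏ A, S.σ A| = 1 := by
  have h := congrArg abs S.prod_σ_mul_self
  rw [abs_mul, abs_one] at h
  nlinarith [abs_nonneg (∏ A, S.σ A)]

theorem gram_basisFun_det_ne_zero : (gram S.η (Pi.basisFun ℝ (Fin (n + 1)))).det ≠ 0 := by
  rw [gram_basisFun, Matrix.det_diagonal]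
  exact left_ne_zero_of_mul_eq_one S.prod_σ_mul_self

theorem dualVec_basisFun (A : Fin (n + 1)) :
    dualVec S.η (Pi.basisFun ℝ (Fin (n + 1))) A = S.σ A • Pi.basisFun ℝ (Fin (n + 1)) A := by
  have h : (gram S.η (Pi.basisFun ℝ (Fin (n + 1))))⁻¹ = Matrix.diagonal S.σ := by
    rw [gram_basisFun]
    apply Matrix.inv_eq_left_inv
    rw [Matrix.diagonal_mul_diagonal]
    simp [S.σ_mul_self]
  simp [dualVec, h, Matrix.diagonal_apply]

theorem ambientVol_apply (v : Fin (n + 1) → Fin (n + 1) → ℝ) :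
    (ambientVol : (Fin (n + 1) → ℝ) [⋀^Fin (n + 1)]→L[ℝ] ℝ) v = (Matrix.of v).det := by
  change (Pi.basisFun ℝ (Fin (n + 1))).det v = _
  rw [Pi.basisFun_det_apply]

theorem ambientVol_basisFun_sq :
    (ambientVol : (Fin (n + 1) → ℝ) [⋀^Fin (n + 1)]→L[ℝ] ℝ)
      (fun l => Pi.basisFun ℝ (Fin (n + 1)) (Equiv.refl _ l)) ^ 2 =
      |(gram S.η (Pi.basisFun ℝ (Fin (n + 1)))).det| := by
  have h : (ambientVol : (Fin (n + 1) → ℝ) [⋀^Fin (n + 1)]→L[ℝ] ℝ)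
      (fun l => Pi.basisFun ℝ (Fin (n + 1)) (Equiv.refl _ l)) = 1 :=
    (Pi.basisFun ℝ (Fin (n + 1))).det_self
  rw [h, gram_basisFun, Matrix.det_diagonal, S.abs_prod_σ, one_pow]

/-! ## The tangent spaces -/

theorem η_self_of_mem_sphere (p : S.sphere) : S.η p p = -S.ε * (S.H ^ 2)⁻¹ := p.2

theorem mem_tangent {p : S.sphere} {v : Fin (n + 1) → ℝ} : v ∈ S.tangent p ↔ S.η p v = 0 :=
  LinearMap.mem_ker

theorem η_tangent (p : S.sphere) (v : S.tangent p) : S.η p v = 0 := S.mem_tangent.1 v.2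

theorem finrank_tangent (p : S.sphere) : Module.finrank ℝ (S.tangent p) = n := by
  have h0 : S.η p ≠ 0 := by
    intro h
    exact S.sphere_self_ne_zero p (by rw [h]; rfl)
  have h := Module.Dual.finrank_ker_add_one_of_ne_zero h0
  rw [Module.finrank_fin_fun] at h
  exact Nat.succ_injective h

theorem sphereMetric_apply (p : S.sphere) (u v : S.tangent p) :
    S.sphereMetric p u v = S.η u v := rfl

theorem sphereVol_apply (p : S.sphere) (w : Fin n → S.tangent p) :
    S.sphereVol p w = (-1) ^ n * (S.H * ambientVol (Fin.cons (p : Fin (n + 1) → ℝ)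
      fun i => (w i : Fin (n + 1) → ℝ))) := by
  have h1 : S.sphereVol p w = (-1) ^ n * ambientVol (Sum.elim (fun _ : Fin 1 =>
      S.H • (p : Fin (n + 1) → ℝ)) (fun i => (w i : Fin (n + 1) → ℝ)) ∘
      (blockEquiv (Nat.add_comm 1 n)).symm) := rfl
  rw [h1, sumElim_comp_blockEquiv_symm_one]
  congr 1
  have h2 := (ambientVol (n := n)).curryLeft.map_smul S.H (p : Fin (n + 1) → ℝ)
  exact congrArg (fun F => F fun i => (w i : Fin (n + 1) → ℝ)) h2

theorem ambientVol_tangent_eq_zero (p : S.sphere) (w : Fin (n + 1) → S.tangent p) :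
    ambientVol (fun i => (w i : Fin (n + 1) → ℝ)) = 0 := by
  refine (ambientVol (n := n)).toAlternatingMap.map_linearDependent _ fun h => ?_
  have h' : LinearIndependent ℝ w := by
    apply LinearIndependent.of_comp (S.tangent p).subtype
    exact h
  have := h'.fintype_card_le_finrank
  rw [S.finrank_tangent, Fintype.card_fin] at this
  omega

/-! ### Bases of a tangent space: determinants and traces -/

section TangentBasis

variable {ι : Type*} [Fintype ι] [DecidableEq ι] (p : S.sphere)
  (f : Module.Basis ι ℝ (S.tangent p)) (e : Fin n ≃ ι)

/-- Two evaluations of the Gram determinant of $(p,f)$: as $\det(X\,\mathrm{diag}(\sigma)X^{T})$,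
and as a block determinant because $p\perp T_p\Sigma_n$. -/
theorem gram_tangent_det :
    (∏ A, S.σ A) * ambientVol (Fin.cons (p : Fin (n + 1) → ℝ)
      fun i => (f (e i) : Fin (n + 1) → ℝ)) ^ 2 =
      S.η p p * (gram (S.sphereMetric p) f).det := by
  set X : Matrix (Fin (n + 1)) (Fin (n + 1)) ℝ :=
    Matrix.of (Fin.cons (p : Fin (n + 1) → ℝ) fun i => (f (e i) : Fin (n + 1) → ℝ)) with hX
  have hX0 : X 0 = p := rfl
  have hXs : ∀ i : Fin n, X i.succ = f (e i) := fun i => rfl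
  have hG : ∀ i j, (X * Matrix.diagonal S.σ * X.transpose) i j = S.η (X i) (X j) := by
    intro i j
    rw [Matrix.mul_apply, η_apply]
    simp only [Matrix.mul_diagonal, Matrix.transpose_apply]
    exact Finset.sum_congr rfl fun A _ => by ring
  have h1 : (X * Matrix.diagonal S.σ * X.transpose).det = (∏ A, S.σ A) * X.det ^ 2 := by
    rw [Matrix.det_mul, Matrix.det_mul, Matrix.det_transpose, Matrix.det_diagonal]
    ring
  have h2 : (X * Matrix.diagonal S.σ * X.transpose).det =
      S.η p p * (gram (S.sphereMetric p) f).det := by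
    rw [Matrix.det_succ_row_zero, Fin.sum_univ_succ, Finset.sum_eq_zero]
    · have : (X * Matrix.diagonal S.σ * X.transpose).submatrix Fin.succ (Fin.succAbove 0) =
          (gram (S.sphereMetric p) f).submatrix e e := by
        ext i j
        rw [Matrix.submatrix_apply, hG, Matrix.submatrix_apply, Fin.zero_succAbove]
        rw [hXs, hXs]
        rfl
      rw [this, Matrix.det_submatrix_equiv_self, hG, hX0]
      simp
    · intro j _
      rw [hG, hX0, hXs, S.η_tangent]
      simp
  rw [ambientVol_apply, ← h1, h2]

omit [Fintype ι] [DecidableEq ι] in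
theorem ambientVol_cons_tangent_ne_zero :
    ambientVol (Fin.cons (p : Fin (n + 1) → ℝ) fun i => (f (e i) : Fin (n + 1) → ℝ)) ≠ 0 := by
  have hli : LinearIndependent ℝ (Fin.cons (p : Fin (n + 1) → ℝ)
      fun i => (f (e i) : Fin (n + 1) → ℝ) : Fin (n + 1) → Fin (n + 1) → ℝ) := by
    rw [linearIndependent_finCons]
    constructor
    · exact (f.linearIndependent.comp e e.injective).map' (S.tangent p).subtype
        (Submodule.ker_subtype _)
    · intro hp
      have hle : Submodule.span ℝ (Set.range fun i => (f (e i) : Fin (n + 1) → ℝ)) ≤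
          S.tangent p := by
        rw [Submodule.span_le]
        rintro _ ⟨i, rfl⟩
        exact (f (e i)).2
      exact S.sphere_self_ne_zero p (S.mem_tangent.1 (hle hp))
  rw [ambientVol_apply]
  have := (Matrix.linearIndependent_rows_iff_isUnit (A := Matrix.of (Fin.cons
    (p : Fin (n + 1) → ℝ) fun i => (f (e i) : Fin (n + 1) → ℝ) :
    Fin (n + 1) → Fin (n + 1) → ℝ))).1 hli
  exact ((Matrix.isUnit_iff_isUnit_det _).1 this).ne_zero

include e in
theorem gram_tangent_det_ne_zero : (gram (S.sphereMetric p) f).det ≠ 0 := by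
  intro h
  have h1 := S.gram_tangent_det p f e
  rw [h, mul_zero] at h1
  exact mul_ne_zero (left_ne_zero_of_mul_eq_one S.prod_σ_mul_self)
    (pow_ne_zero 2 (S.ambientVol_cons_tangent_ne_zero p f e)) h1

/-- The factor `H` in the unit normal compensates $|\eta(p,p)|=H^{-2}$. This is the normalisation
that the inverse-star lemmas require. -/
theorem sphereVol_sq :
    S.sphereVol p (fun i => f (e i)) ^ 2 = |(gram (S.sphereMetric p) f).det| := by
  have h1 := congrArg abs (S.gram_tangent_det p f e)
  rw [abs_mul, abs_mul, S.abs_prod_σ, one_mul, abs_of_nonneg (sq_nonneg _),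
    S.η_self_of_mem_sphere, abs_mul, abs_neg] at h1
  have hε : |S.ε| = 1 := by rcases S.ε_eq with h | h <;> rw [h] <;> simp
  have hH := S.H_pos
  rw [hε, one_mul, abs_of_pos (by positivity)] at h1
  rw [sphereVol_apply, mul_pow, mul_pow, h1, ← pow_mul, mul_comm n 2, pow_mul]
  norm_num
  field_simp

include e in
/-- The trace over the ambient space is the trace over the tangent space plus the radial term. -/
theorem sum_basisFun_eq_tangent_add (T : (Fin (n + 1) → ℝ) →ₗ[ℝ] (Fin (n + 1) → ℝ) →ₗ[ℝ] ℝ) :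
    ∑ A, T (Pi.basisFun ℝ _ A) (dualVec S.η (Pi.basisFun ℝ _) A) =
      ∑ c, T (f c) (dualVec (S.sphereMetric p) f c : S.tangent p) + (S.η p p)⁻¹ * T p p := by
  have h0 := S.sphere_self_ne_zero p
  have hdet := S.gram_tangent_det_ne_zero p f e
  -- Tangential projection, expanded through the dual basis, plus radial component.
  have hexp : ∀ v : Fin (n + 1) → ℝ, v = ∑ c, S.η v (dualVec (S.sphereMetric p) f c : S.tangent p) •
      (f c : Fin (n + 1) → ℝ) + ((S.η p p)⁻¹ * S.η v p) • (p : Fin (n + 1) → ℝ) := by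
    intro v
    have h1 := sum_apply_dualVec_smul (S.sphereMetric p) (fun u v => S.η_comm u v) f hdet
      (S.tangentProj p v)
    have h2 := congrArg (S.tangent p).subtype h1
    have hP : (S.tangentProj p v : Fin (n + 1) → ℝ) =
        v - ((S.η p p)⁻¹ * S.η p v) • (p : Fin (n + 1) → ℝ) := rfl
    simp only [map_sum, map_smul, Submodule.subtype_apply, sphereMetric_apply, hP] at h2
    have h3 : ∀ c, S.η (v - ((S.η p p)⁻¹ * S.η p v) • (p : Fin (n + 1) → ℝ))
        (dualVec (S.sphereMetric p) f c : S.tangent p) =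
        S.η v (dualVec (S.sphereMetric p) f c : S.tangent p) := by
      intro c
      rw [map_sub, map_smul, LinearMap.sub_apply, LinearMap.smul_apply, S.η_tangent, smul_zero,
        sub_zero]
    simp only [h3] at h2
    rw [h2, S.η_comm v p, sub_add_cancel]
  have hrec : ∀ v : Fin (n + 1) → ℝ, ∑ A, S.η (Pi.basisFun ℝ _ A) v •
      dualVec S.η (Pi.basisFun ℝ (Fin (n + 1))) A = v := by
    intro v
    funext B
    simp only [dualVec_basisFun, η_apply]
    simp [Finset.sum_apply, Pi.single_apply, mul_right_comm _ (v B), S.σ_mul_self]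
  calc ∑ A, T (Pi.basisFun ℝ _ A) (dualVec S.η (Pi.basisFun ℝ _) A)
      = ∑ A, (∑ c, T (f c) (S.η (Pi.basisFun ℝ _ A)
          (dualVec (S.sphereMetric p) f c : S.tangent p) • dualVec S.η (Pi.basisFun ℝ _) A) +
          (S.η p p)⁻¹ * T p (S.η (Pi.basisFun ℝ _ A) p • dualVec S.η (Pi.basisFun ℝ _) A)) := by
        refine Finset.sum_congr rfl fun A _ => ?_
        conv_lhs => rw [hexp (Pi.basisFun ℝ _ A)]
        simp only [map_add, map_sum, map_smul, LinearMap.add_apply, LinearMap.sum_apply,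
          LinearMap.smul_apply, smul_eq_mul, mul_assoc]
    _ = _ := by
        rw [Finset.sum_add_distrib, Finset.sum_comm, ← Finset.mul_sum]
        simp only [← map_sum, hrec]

include e in
-- For a product the radial term of the trace is $\varphi(p)\psi(p)$ up to a factor, so it drops out
-- as soon as one functional kills `p`.
theorem sum_mul_basisFun_eq_tangent (φ ψ : (Fin (n + 1) → ℝ) →L[ℝ] ℝ)
    (h : φ (p : Fin (n + 1) → ℝ) * ψ (p : Fin (n + 1) → ℝ) = 0) :
    ∑ c, φ (f c) * ψ (dualVec (S.sphereMetric p) f c : S.tangent p) =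
      ∑ A, φ (Pi.basisFun ℝ _ A) * ψ (dualVec S.η (Pi.basisFun ℝ _) A) := by
  have := S.sum_basisFun_eq_tangent_add p f e
    ((LinearMap.mul ℝ ℝ).compl₁₂ φ.toLinearMap ψ.toLinearMap)
  simp only [LinearMap.compl₁₂_apply, LinearMap.mul_apply', ContinuousLinearMap.coe_coe, h,
    mul_zero, add_zero] at this
  exact this.symm

end TangentBasis

/-! ## The Hodge stars of the sphere and of the ambient space -/

theorem coe_comp_cons (p : S.sphere) {m : ℕ} (x : S.tangent p) (w : Fin m → S.tangent p) :
    (fun i => ((Fin.cons x w : Fin (m + 1) → S.tangent p) i : Fin (n + 1) → ℝ)) =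
      Fin.cons (x : Fin (n + 1) → ℝ) fun i => (w i : Fin (n + 1) → ℝ) := by
  funext i
  cases i using Fin.cases <;> simp

section Star

variable {ι : Type*} [Fintype ι] [DecidableEq ι] (p : S.sphere)
  (f : Module.Basis ι ℝ (S.tangent p))

theorem sum_oneForm_mul_eq (e : Fin n ≃ ι) {m : ℕ} (α : (Fin (n + 1) → ℝ) [⋀^Fin 1]→L[ℝ] ℝ)
    (Λ : (Fin (n + 1) → ℝ) [⋀^Fin (m + 1)]→L[ℝ] ℝ) (z : Fin m → Fin (n + 1) → ℝ)
    (h : α (fun _ => (p : Fin (n + 1) → ℝ)) = 0 ∨ Λ (Fin.cons (p : Fin (n + 1) → ℝ) z) = 0) :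
    ∑ c, α (fun _ => (f c : Fin (n + 1) → ℝ)) *
      Λ (Fin.cons ((dualVec (S.sphereMetric p) f c : S.tangent p) : Fin (n + 1) → ℝ) z) =
      ∑ A, α (fun _ => Pi.basisFun ℝ _ A) *
        Λ (Fin.cons (dualVec S.η (Pi.basisFun ℝ _) A) z) :=
  S.sum_mul_basisFun_eq_tangent p f e
    ((ContinuousAlternatingMap.ofSubsingleton ℝ _ ℝ (0 : Fin 1)).symm α)
    ((ContinuousAlternatingMap.apply ℝ _ ℝ z).comp Λ.curryLeft) (mul_eq_zero.2 h)

theorem sum_twoForm_mul_eq (e : Fin n ≃ ι) {m : ℕ} (α : (Fin (n + 1) → ℝ) [⋀^Fin 2]→L[ℝ] ℝ)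
    (Λ : (Fin (n + 1) → ℝ) [⋀^Fin (m + 2)]→L[ℝ] ℝ) (z : Fin m → Fin (n + 1) → ℝ)
    (h : (∀ x, α ![x, (p : Fin (n + 1) → ℝ)] = 0) ∨
      ∀ x, Λ (Fin.cons x (Fin.cons (p : Fin (n + 1) → ℝ) z)) = 0) :
    ∑ c, ∑ c', α ![(f c : Fin (n + 1) → ℝ), (f c' : Fin (n + 1) → ℝ)] *
      Λ (Fin.cons ((dualVec (S.sphereMetric p) f c : S.tangent p) : Fin (n + 1) → ℝ)
        (Fin.cons ((dualVec (S.sphereMetric p) f c' : S.tangent p) : Fin (n + 1) → ℝ) z)) =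
      ∑ A, ∑ B, α ![Pi.basisFun ℝ _ A, Pi.basisFun ℝ _ B] *
        Λ (Fin.cons (dualVec S.η (Pi.basisFun ℝ _) A)
          (Fin.cons (dualVec S.η (Pi.basisFun ℝ _) B) z)) := by
  have h1 : ∀ x y, ∑ c, α ![x, (f c : Fin (n + 1) → ℝ)] * Λ (Fin.cons y
      (Fin.cons ((dualVec (S.sphereMetric p) f c : S.tangent p) : Fin (n + 1) → ℝ) z)) =
      ∑ A, α ![x, Pi.basisFun ℝ _ A] *
        Λ (Fin.cons y (Fin.cons (dualVec S.η (Pi.basisFun ℝ _) A) z)) := fun x y =>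
    S.sum_mul_basisFun_eq_tangent p f e
      ((ContinuousAlternatingMap.apply ℝ _ ℝ ![]).comp (α.curryLeft x).curryLeft)
      ((ContinuousAlternatingMap.apply ℝ _ ℝ z).comp (Λ.curryLeft y).curryLeft)
      (mul_eq_zero.2 (h.imp (fun h => h x) fun h => h y))
  have h2 : ∀ x y, ∑ c, α ![(f c : Fin (n + 1) → ℝ), x] *
      Λ (Fin.cons ((dualVec (S.sphereMetric p) f c : S.tangent p) : Fin (n + 1) → ℝ)
        (Fin.cons y z)) =
      ∑ A, α ![Pi.basisFun ℝ _ A, x] *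
        Λ (Fin.cons (dualVec S.η (Pi.basisFun ℝ _) A) (Fin.cons y z)) := fun x y =>
    S.sum_mul_basisFun_eq_tangent p f e
      ((ContinuousAlternatingMap.apply ℝ _ ℝ ![x]).comp α.curryLeft)
      ((ContinuousAlternatingMap.apply ℝ _ ℝ (Fin.cons y z)).comp Λ.curryLeft)
      (mul_eq_zero.2 (h.imp
        (fun h => (α.map_cons_cons_swap _ x ![]).trans (neg_eq_zero.2 (h x)))
        (fun h => (Λ.map_cons_cons_swap _ y z).trans (neg_eq_zero.2 (h y)))))
  simp only [h1]
  rw [Finset.sum_comm]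
  simp only [h2]
  rw [Finset.sum_comm]

/-- The volume form of $\Sigma_n$ carries `p` in its first slot. A radial contraction would insert
`p` twice, so the tangential contraction may be replaced by the ambient one. Moving `p` past one
dual vector turns $(-1)^n$ into $(-1)^{n+1}$. -/
theorem sphere_hodgeStar_one (e : Fin n ≃ ι) {m : ℕ} (h : 1 + m = n) (h' : 1 + (m + 1) = n + 1)
    (α : (Fin (n + 1) → ℝ) [⋀^Fin 1]→L[ℝ] ℝ) (w : Fin m → S.tangent p) :
    hodgeStar (S.sphereMetric p) f h (S.sphereVol p)
      (α.compContinuousLinearMap (S.tangent p).subtypeL) w =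
      ((-1) ^ (n + 1) * S.H) * hodgeStar S.η (Pi.basisFun ℝ _) h' ambientVol α
        (Fin.cons (p : Fin (n + 1) → ℝ) fun i => (w i : Fin (n + 1) → ℝ)) := by
  obtain rfl : n = m + 1 := by omega
  rw [hodgeStar_one_apply, hodgeStar_one_apply]
  simp only [sphereVol_apply, coe_comp_cons]
  generalize (ambientVol : (Fin (m + 1 + 1) → ℝ) [⋀^Fin (m + 1 + 1)]→L[ℝ] ℝ) = Λ
  rw [← S.sum_oneForm_mul_eq p f e _ _ _ (Or.inr (Λ.map_cons_cons_self _ _)), Finset.mul_sum]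
  refine Finset.sum_congr rfl fun c _ => ?_
  have hα : (α.compContinuousLinearMap (S.tangent p).subtypeL) (fun _ => f c) =
      α (fun _ => (f c : Fin (m + 1 + 1) → ℝ)) := rfl
  rw [Λ.map_cons_cons_swap, hα]
  ring

theorem sphere_hodgeStar_two (e : Fin n ≃ ι) {m : ℕ} (h : 2 + m = n) (h' : 2 + (m + 1) = n + 1)
    (α : (Fin (n + 1) → ℝ) [⋀^Fin 2]→L[ℝ] ℝ) (w : Fin m → S.tangent p) :
    hodgeStar (S.sphereMetric p) f h (S.sphereVol p)
      (α.compContinuousLinearMap (S.tangent p).subtypeL) w =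
      ((-1) ^ (n + 2) * S.H) * hodgeStar S.η (Pi.basisFun ℝ _) h' ambientVol α
        (Fin.cons (p : Fin (n + 1) → ℝ) fun i => (w i : Fin (n + 1) → ℝ)) := by
  obtain rfl : n = m + 2 := by omega
  rw [hodgeStar_two_apply, hodgeStar_two_apply]
  simp only [sphereVol_apply, coe_comp_cons]
  generalize (ambientVol : (Fin (m + 2 + 1) → ℝ) [⋀^Fin (m + 2 + 1)]→L[ℝ] ℝ) = Λ
  rw [← S.sum_twoForm_mul_eq p f e _ _ _
    (Or.inr fun x => (Λ.curryLeft x).map_cons_cons_self _ _), mul_left_comm]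
  congr 1
  rw [Finset.mul_sum]
  refine Finset.sum_congr rfl fun c _ => ?_
  rw [Finset.mul_sum]
  refine Finset.sum_congr rfl fun c' _ => ?_
  have hα : (α.compContinuousLinearMap (S.tangent p).subtypeL) ![f c, f c'] =
      α ![(f c : Fin (m + 2 + 1) → ℝ), (f c' : Fin (m + 2 + 1) → ℝ)] := by
    rw [ContinuousAlternatingMap.compContinuousLinearMap_apply]
    congr 1
    funext i
    fin_cases i <;> rfl
  -- For two-forms `p` passes two dual vectors, so no sign appears.
  have hv : ∀ (x y q : Fin (m + 2 + 1) → ℝ) (w : Fin m → Fin (m + 2 + 1) → ℝ),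
      Λ (Fin.cons q (Fin.cons x (Fin.cons y w))) = Λ (Fin.cons x (Fin.cons y (Fin.cons q w))) := by
    intro x y q w
    have h1 : Λ (Fin.cons x (Fin.cons q (Fin.cons y w))) =
        -Λ (Fin.cons x (Fin.cons y (Fin.cons q w))) := (Λ.curryLeft x).map_cons_cons_swap _ _ _
    rw [Λ.map_cons_cons_swap, h1, neg_neg]
  rw [hα, hv]
  ring

/-- An enumeration of the index type of a basis of the tangent space. -/
def tangentEquiv : Fin n ≃ Fin (Module.finrank ℝ (S.tangent p)) :=
  finCongr (S.finrank_tangent p).symm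

/-- Since `α` kills `p`, the contraction runs over tangent vectors only, and the ambient volume form
vanishes on $n+1$ vectors of the $n$-dimensional tangent space. -/
theorem ambient_hodgeStar_one_tangent {m : ℕ} (h' : 1 + (m + 1) = n + 1)
    (α : (Fin (n + 1) → ℝ) [⋀^Fin 1]→L[ℝ] ℝ) (hα : α.curryLeft (p : Fin (n + 1) → ℝ) = 0)
    (w : Fin (m + 1) → S.tangent p) :
    hodgeStar S.η (Pi.basisFun ℝ _) h' ambientVol α (fun i => (w i : Fin (n + 1) → ℝ)) = 0 := by
  obtain rfl : n = m + 1 := by omega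
  have hp : α (fun _ => (p : Fin (m + 1 + 1) → ℝ)) = 0 := by
    have h1 : α.curryLeft (p : Fin (m + 1 + 1) → ℝ) ![] = 0 := by rw [hα]; rfl
    rw [← h1, ContinuousAlternatingMap.curryLeft_apply_apply]
    congr 1
    funext i
    rw [Subsingleton.elim i 0]
    rfl
  rw [hodgeStar_one_apply, ← S.sum_oneForm_mul_eq p (Module.finBasis ℝ (S.tangent p))
    (S.tangentEquiv p) _ _ _ (Or.inl hp)]
  refine Finset.sum_eq_zero fun c _ => ?_
  rw [← S.coe_comp_cons, S.ambientVol_tangent_eq_zero, mul_zero]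

theorem ambient_hodgeStar_two_tangent {m : ℕ} (h' : 2 + (m + 1) = n + 1)
    (α : (Fin (n + 1) → ℝ) [⋀^Fin 2]→L[ℝ] ℝ) (hα : α.curryLeft (p : Fin (n + 1) → ℝ) = 0)
    (w : Fin (m + 1) → S.tangent p) :
    hodgeStar S.η (Pi.basisFun ℝ _) h' ambientVol α (fun i => (w i : Fin (n + 1) → ℝ)) = 0 := by
  obtain rfl : n = m + 2 := by omega
  have hp1 : ∀ x, α ![(p : Fin (m + 2 + 1) → ℝ), x] = 0 := fun x =>
    congrArg (fun F => F ![x]) hα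
  have hp2 : ∀ x, α ![x, (p : Fin (m + 2 + 1) → ℝ)] = 0 := fun x =>
    (α.map_cons_cons_swap x p ![]).trans (neg_eq_zero.2 (hp1 x))
  rw [hodgeStar_two_apply, ← S.sum_twoForm_mul_eq p (Module.finBasis ℝ (S.tangent p))
    (S.tangentEquiv p) _ _ _ (Or.inl hp2), Finset.sum_eq_zero, mul_zero]
  intro c _
  refine Finset.sum_eq_zero fun c' _ => ?_
  rw [← S.coe_comp_cons, ← S.coe_comp_cons, S.ambientVol_tangent_eq_zero, mul_zero]

end Star

end PseudoSphereData

end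

noncomputable section

namespace PseudoSphereData

variable {n : ℕ} (S : PseudoSphereData n)

/-! ## The cone and the radius -/

theorem mem_cone_iff {y : Fin (n + 1) → ℝ} : y ∈ S.cone ↔ 0 < -S.ε * S.η y y := by
  change Real.sign (S.η y y) = -S.ε ↔ _
  rcases S.ε_eq with e | e <;> rcases lt_trichotomy (S.η y y) 0 with h | h | h
  · simp [Real.sign_of_neg h, e, h]
  · simp [h, e]
  · rw [Real.sign_of_pos h, e]; constructor <;> intro h' <;> linarith
  · rw [Real.sign_of_neg h, e]; constructor <;> intro h' <;> linarith
  · simp [h, e]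
  · simp [Real.sign_of_pos h, e, h]

theorem abs_η_of_mem_cone {y : Fin (n + 1) → ℝ} (hy : y ∈ S.cone) :
    |S.η y y| = -S.ε * S.η y y := by
  have h := S.mem_cone_iff.1 hy
  rw [← abs_of_pos h, abs_mul, abs_neg]
  rcases S.ε_eq with e | e <;> simp [e]

theorem radius_eq_of_mem_cone {y : Fin (n + 1) → ℝ} (hy : y ∈ S.cone) :
    S.radius y = S.H * √(-S.ε * S.η y y) := by
  rw [radius, S.abs_η_of_mem_cone hy]

theorem radius_pos {y : Fin (n + 1) → ℝ} (hy : y ∈ S.cone) : 0 < S.radius y := by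
  rw [S.radius_eq_of_mem_cone hy]
  exact mul_pos S.H_pos (Real.sqrt_pos.2 (S.mem_cone_iff.1 hy))

theorem sphere_subset_cone (p : S.sphere) : (p : Fin (n + 1) → ℝ) ∈ S.cone := by
  have hH := S.H_pos
  rw [mem_cone_iff, S.η_self_of_mem_sphere,
    show -S.ε * (-S.ε * (S.H ^ 2)⁻¹) = S.ε * S.ε * (S.H ^ 2)⁻¹ by ring, S.ε_mul_self]
  positivity

theorem radius_sphere (p : S.sphere) : S.radius p = 1 := by
  have hH := S.H_pos
  rw [S.radius_eq_of_mem_cone (S.sphere_subset_cone p), S.η_self_of_mem_sphere,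
    show -S.ε * (-S.ε * (S.H ^ 2)⁻¹) = S.ε * S.ε * (S.H⁻¹) ^ 2 by ring, S.ε_mul_self, one_mul,
    Real.sqrt_sq (by positivity), mul_inv_cancel₀ hH.ne']

theorem smul_mem_cone {y : Fin (n + 1) → ℝ} (hy : y ∈ S.cone) {c : ℝ} (hc : 0 < c) :
    c • y ∈ S.cone := by
  have h := S.mem_cone_iff.1 hy
  rw [mem_cone_iff, map_smul, map_smul, LinearMap.smul_apply, smul_eq_mul, smul_eq_mul,
    show -S.ε * (c * (c * S.η y y)) = c * c * (-S.ε * S.η y y) by ring]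
  positivity

theorem radius_smul (y : Fin (n + 1) → ℝ) {c : ℝ} (hc : 0 < c) :
    S.radius (c • y) = c * S.radius y := by
  rw [radius, radius, map_smul, map_smul, LinearMap.smul_apply, smul_eq_mul, smul_eq_mul,
    ← mul_assoc, abs_mul, abs_of_pos (mul_pos hc hc), Real.sqrt_mul (mul_pos hc hc).le,
    Real.sqrt_mul_self hc.le]
  ring

theorem radial_smul {y : Fin (n + 1) → ℝ} (hy : y ∈ S.cone) {c : ℝ} (hc : 0 < c)
    (hcy : c • y ∈ S.cone) : S.radial (c • y) hcy = S.radial y hy := by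
  apply Subtype.ext
  change (S.radius (c • y))⁻¹ • c • y = (S.radius y)⁻¹ • y
  rw [S.radius_smul y hc, smul_smul, mul_inv, mul_assoc, mul_comm _ c, ← mul_assoc,
    inv_mul_cancel₀ hc.ne', one_mul]

theorem radial_sphere (p : S.sphere) (hp : (p : Fin (n + 1) → ℝ) ∈ S.cone) :
    S.radial p hp = p := by
  apply Subtype.ext
  change (S.radius p)⁻¹ • (p : Fin (n + 1) → ℝ) = p
  rw [S.radius_sphere, inv_one, one_smul]

/-- The metric as a continuous bilinear map. -/
def ηL : (Fin (n + 1) → ℝ) →L[ℝ] (Fin (n + 1) → ℝ) →L[ℝ] ℝ :=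
  LinearMap.toContinuousBilinearMap S.η

theorem hasFDerivAt_η_self (y : Fin (n + 1) → ℝ) :
    HasFDerivAt (fun z => S.η z z) ((2 : ℝ) • S.ηL y) y := by
  have h := S.ηL.hasFDerivAt_of_bilinear (hasFDerivAt_id y) (hasFDerivAt_id y)
  refine HasFDerivAt.congr_fderiv h (ContinuousLinearMap.ext fun u => ?_)
  change S.η y u + S.η u y = 2 * S.η y u
  rw [S.η_comm u y]
  ring

theorem contDiff_η_self : ContDiff ℝ ∞ fun z => S.η z z := by
  change ContDiff ℝ ∞ fun z => S.ηL z z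
  fun_prop

theorem isOpen_cone : IsOpen S.cone := by
  have : S.cone = {y | 0 < -S.ε * S.η y y} := Set.ext fun y => S.mem_cone_iff
  rw [this]
  exact isOpen_lt continuous_const (continuous_const.mul S.contDiff_η_self.continuous)

theorem cone_mem_nhds {y : Fin (n + 1) → ℝ} (hy : y ∈ S.cone) : S.cone ∈ nhds y :=
  S.isOpen_cone.mem_nhds hy

theorem hasFDerivAt_radius {y : Fin (n + 1) → ℝ} (hy : y ∈ S.cone) :
    HasFDerivAt S.radius ((-S.ε * S.H ^ 2 * (S.radius y)⁻¹) • S.ηL y) y := by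
  have h0 := S.mem_cone_iff.1 hy
  have h1 := ((((S.hasFDerivAt_η_self y).const_mul (-S.ε)).sqrt h0.ne').const_mul S.H)
  -- The cone is open and the sign of $\eta(y,y)$ is constant on it, so the absolute value can be
  -- removed before differentiating.
  have h2 : S.radius =ᶠ[nhds y] fun z => S.H * √(-S.ε * S.η z z) :=
    Filter.eventuallyEq_of_mem (S.cone_mem_nhds hy) fun z hz => S.radius_eq_of_mem_cone hz
  refine (h1.congr_of_eventuallyEq h2).congr_fderiv ?_
  rw [S.radius_eq_of_mem_cone hy, smul_smul, smul_smul, smul_smul]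
  congr 1
  have h3 : √(-S.ε * S.η y y) ≠ 0 := (Real.sqrt_pos.2 h0).ne'
  have hH := S.H_pos.ne'
  field_simp

theorem hasFDerivAt_radius_rpow {y : Fin (n + 1) → ℝ} (hy : y ∈ S.cone) (s : ℝ) :
    HasFDerivAt (fun z => S.radius z ^ s)
      ((-S.ε * S.H ^ 2 * s * S.radius y ^ (s - 2)) • S.ηL y) y := by
  have h0 := S.radius_pos hy
  refine ((S.hasFDerivAt_radius hy).rpow_const (p := s) (Or.inl h0.ne')).congr_fderiv ?_
  rw [smul_smul]
  congr 1
  rw [show s - 1 = (s - 2) + 1 by ring, Real.rpow_add h0, Real.rpow_one]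
  field_simp

theorem contDiffOn_radius_rpow (s : ℝ) : ContDiffOn ℝ ∞ (fun z => S.radius z ^ s) S.cone := by
  have h1 : ContDiffOn ℝ ∞ (fun z => (S.H * √(-S.ε * S.η z z)) ^ s) S.cone := by
    have hq : ContDiffOn ℝ ∞ (fun z => -S.ε * S.η z z) S.cone :=
      (contDiff_const.mul S.contDiff_η_self).contDiffOn
    refine ContDiffOn.rpow_const_of_ne (contDiffOn_const.mul
      (hq.sqrt fun z hz => (S.mem_cone_iff.1 hz).ne')) fun z hz => ?_
    rw [← S.radius_eq_of_mem_cone hz]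
    exact (S.radius_pos hz).ne'
  exact h1.congr fun z hz => by rw [S.radius_eq_of_mem_cone hz]

/-! ## Extensions -/

section Ext

variable {k : ℕ}

theorem ext_of_mem (s : ℝ) (β : S.SphereForm k) {y : Fin (n + 1) → ℝ} (hy : y ∈ S.cone) :
    S.ext s β y = (S.radius y) ^ (s - k) •
      (β (S.radial y hy)).compContinuousLinearMap (S.tangentProj (S.radial y hy)) := by
  rw [ext, dif_pos hy]

theorem ext_eq_rpow_smul (s : ℝ) (β : S.SphereForm k) {y : Fin (n + 1) → ℝ} (hy : y ∈ S.cone) :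
    S.ext s β y = (S.radius y) ^ s • S.ext 0 β y := by
  rw [S.ext_of_mem s β hy, S.ext_of_mem 0 β hy, smul_smul, ← Real.rpow_add (S.radius_pos hy)]
  congr 2
  ring

theorem ext_zero_of_mem (β : S.SphereForm k) {y : Fin (n + 1) → ℝ} (hy : y ∈ S.cone) :
    S.ext 0 β y = ((S.radius y) ^ k)⁻¹ •
      (β (S.radial y hy)).compContinuousLinearMap (S.tangentProj (S.radial y hy)) := by
  rw [S.ext_of_mem 0 β hy, zero_sub, Real.rpow_neg (S.radius_pos hy).le, Real.rpow_natCast]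

theorem ext_zero_smul (β : S.SphereForm k) {y : Fin (n + 1) → ℝ} (hy : y ∈ S.cone) {c : ℝ}
    (hc : 0 < c) : S.ext 0 β (c • y) = (c ^ k)⁻¹ • S.ext 0 β y := by
  have hcy := S.smul_mem_cone hy hc
  rw [S.ext_zero_of_mem β hcy, S.ext_zero_of_mem β hy, S.radius_smul y hc, smul_smul,
    S.radial_smul hy hc, mul_pow, mul_inv]

theorem coe_tangentProj (p : S.sphere) (v : Fin (n + 1) → ℝ) :
    (S.tangentProj p v : Fin (n + 1) → ℝ) =
      v - ((S.η p p)⁻¹ * S.η p v) • (p : Fin (n + 1) → ℝ) := rfl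

theorem tangentProj_self (p : S.sphere) : S.tangentProj p p = 0 := by
  apply Subtype.ext
  rw [coe_tangentProj, inv_mul_cancel₀ (S.sphere_self_ne_zero p), one_smul, sub_self]
  rfl

theorem tangentProj_coe (p : S.sphere) (v : S.tangent p) : S.tangentProj p v = v := by
  apply Subtype.ext
  rw [coe_tangentProj, S.η_tangent, mul_zero, zero_smul, sub_zero]

theorem curryLeft_ext (s : ℝ) (β : S.SphereForm (k + 1)) {y : Fin (n + 1) → ℝ} (hy : y ∈ S.cone) :
    (S.ext s β y).curryLeft y = 0 := by
  have h0 := S.radius_pos hy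
  have hP : S.tangentProj (S.radial y hy) y = 0 := by
    have h1 : S.tangentProj (S.radial y hy) ((S.radius y)⁻¹ • y) = 0 :=
      S.tangentProj_self (S.radial y hy)
    rw [map_smul] at h1
    exact (smul_eq_zero.1 h1).resolve_left (inv_ne_zero h0.ne')
  rw [S.ext_of_mem s β hy, ContinuousAlternatingMap.curryLeft_smul, _root_.smul_apply,
    ContinuousAlternatingMap.curryLeft_compContinuousLinearMap, hP, map_zero]
  ext v
  simp

theorem restr_ext (s : ℝ) (β : S.SphereForm k) : S.restr (S.ext s β) = β := by
  funext p
  have hp := S.sphere_subset_cone p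
  have key : ∀ q : S.sphere, q = p → ((β q).compContinuousLinearMap
      (S.tangentProj q)).compContinuousLinearMap (S.tangent p).subtypeL = β p := by
    rintro q rfl
    ext w
    simp only [ContinuousAlternatingMap.compContinuousLinearMap_apply]
    congr 1
    funext i
    exact S.tangentProj_coe q (w i)
  rw [restr, S.ext_of_mem s β hp, S.radius_sphere, Real.one_rpow, one_smul]
  exact key _ (S.radial_sphere p hp)

/-- A transverse form with the right homogeneity is determined by its values on the tangent spaces
of $\Sigma_n$. It serves to identify the extension of $d_\Sigma b$ with $d(b^{(0)})$. -/
theorem ext_zero_restr (α : (Fin (n + 1) → ℝ) → (Fin (n + 1) → ℝ) [⋀^Fin (k + 1)]→L[ℝ] ℝ)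
    (hh : ∀ y ∈ S.cone, ∀ c : ℝ, 0 < c → α (c • y) = (c ^ (k + 1))⁻¹ • α y)
    (ht : ∀ y ∈ S.cone, (α y).curryLeft y = 0) {y : Fin (n + 1) → ℝ} (hy : y ∈ S.cone) :
    S.ext 0 (S.restr α) y = α y := by
  have h0 := S.radius_pos hy
  set q := S.radial y hy with hq
  have hy' : y = S.radius y • (q : Fin (n + 1) → ℝ) := by
    change y = S.radius y • (S.radius y)⁻¹ • y
    rw [smul_smul, mul_inv_cancel₀ h0.ne', one_smul]
  rw [S.ext_zero_of_mem _ hy]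
  conv_rhs => rw [hy', hh _ (S.sphere_subset_cone q) _ h0]
  congr 1
  ext w
  have h1 := (α q).map_add_smul_of_annihilates (q : Fin (n + 1) → ℝ)
    ((α q).update_eq_zero_of_curryLeft_eq_zero _ (ht _ (S.sphere_subset_cone q))) w
    (fun i => -((S.η q q)⁻¹ * S.η q (w i)))
  rw [← h1]
  change α q _ = α q _
  congr 1
  funext i
  change (S.tangentProj q (w i) : Fin (n + 1) → ℝ) = _
  rw [coe_tangentProj, neg_smul, sub_eq_add_neg]

end Ext

/-! ## Homogeneous functions on the cone -/

section Homogeneous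

variable {F : Type*} [NormedAddCommGroup F] [NormedSpace ℝ F]

/-- Homogeneity of degree `-k` on the cone. -/
def IsHomogeneousNeg (k : ℕ) (α : (Fin (n + 1) → ℝ) → F) : Prop :=
  ∀ y ∈ S.cone, ∀ c : ℝ, 0 < c → α (c • y) = (c ^ k)⁻¹ • α y

variable {S}

theorem IsHomogeneousNeg.fderiv {k : ℕ} {α : (Fin (n + 1) → ℝ) → F}
    (hα : S.IsHomogeneousNeg k α) : S.IsHomogeneousNeg (k + 1) (fderiv ℝ α) := by
  intro y hy c hc
  have h1 : (fun z => α (c • z)) =ᶠ[nhds y] (c ^ k)⁻¹ • α :=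
    Filter.eventuallyEq_of_mem (S.cone_mem_nhds hy) fun z hz => hα z hz c hc
  have h2 := h1.fderiv_eq (𝕜 := ℝ)
  rw [fderiv_comp_smul, fderiv_const_smul_field, Pi.smul_apply] at h2
  have h3 := congrArg (fun T => c⁻¹ • T) h2
  simp only [smul_smul, inv_mul_cancel₀ hc.ne', one_smul] at h3
  rw [h3, pow_succ, mul_inv, mul_comm]

/-- Euler's relation: differentiate $c\mapsto\alpha(cy)$ at $c=1$. -/
theorem IsHomogeneousNeg.fderiv_self {k : ℕ} {α : (Fin (n + 1) → ℝ) → F}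
    (hα : S.IsHomogeneousNeg k α) {y : Fin (n + 1) → ℝ} (hy : y ∈ S.cone)
    (hd : DifferentiableAt ℝ α y) : _root_.fderiv ℝ α y y = -(k : ℝ) • α y := by
  have h1 : HasDerivAt (fun c : ℝ => α (c • y)) (_root_.fderiv ℝ α y y) 1 := by
    have hl : HasDerivAt (fun c : ℝ => c • y) y 1 := by
      simpa using (hasDerivAt_id (1 : ℝ)).smul_const y
    have hd' : HasFDerivAt α (_root_.fderiv ℝ α y) ((1 : ℝ) • y) := by
      rw [one_smul]
      exact hd.hasFDerivAt
    exact hd'.comp_hasDerivAt (1 : ℝ) hl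
  have h2 : HasDerivAt (fun c : ℝ => (c ^ k)⁻¹ • α y) (-(k : ℝ) • α y) 1 := by
    have := ((hasDerivAt_pow k (1 : ℝ)).inv (by simp)).smul_const (α y)
    simpa using this
  have h3 : (fun c : ℝ => α (c • y)) =ᶠ[nhds 1] fun c => (c ^ k)⁻¹ • α y := by
    filter_upwards [Ioi_mem_nhds (zero_lt_one (α := ℝ))] with c hc
    exact hα y hy c hc
  exact h1.unique (h2.congr_of_eventuallyEq h3)

theorem isHomogeneousNeg_ext {k : ℕ} (β : S.SphereForm k) : S.IsHomogeneousNeg k (S.ext 0 β) :=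
  fun _ hy _ hc => S.ext_zero_smul β hy hc

theorem IsHomogeneousNeg.extDeriv {k j : ℕ}
    {α : (Fin (n + 1) → ℝ) → (Fin (n + 1) → ℝ) [⋀^Fin j]→L[ℝ] ℝ}
    (hα : S.IsHomogeneousNeg k α) : S.IsHomogeneousNeg (k + 1) (extDeriv α) := by
  intro y hy c hc
  rw [_root_.extDeriv, hα.fderiv y hy c hc, ContinuousAlternatingMap.alternatizeUncurryFin_smul]
  rfl

end Homogeneous

end PseudoSphereData

end

noncomputable section

/-- Product rule for contraction with the position field; the first term comes from the derivative
of the position itself. -/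
theorem hasFDerivAt_curryLeft_self {V : Type*} [NormedAddCommGroup V] [NormedSpace ℝ V] {m : ℕ}
    {A : V → V [⋀^Fin (m + 1)]→L[ℝ] ℝ} {A' : V →L[ℝ] V [⋀^Fin (m + 1)]→L[ℝ] ℝ} {p : V}
    (hA : HasFDerivAt A A' p) :
    ∃ T : V →L[ℝ] V [⋀^Fin m]→L[ℝ] ℝ, HasFDerivAt (fun y => (A y).curryLeft y) T p ∧
      ∀ u, T u = (A p).curryLeft u + (A' u).curryLeft p := by
  have h1 := (ContinuousAlternatingMap.curryLeftLI (𝕜 := ℝ) (E := V) (F := ℝ)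
    (n := m)).toContinuousLinearMap.hasFDerivAt (x := A p)
  have h2 := HasFDerivAt.comp (G := V →L[ℝ] V [⋀^Fin m]→L[ℝ] ℝ) p h1 hA
  have h3 := h2.clm_apply (hasFDerivAt_id p)
  exact ⟨_, h3, fun u => rfl⟩

namespace PseudoSphereData

variable {n : ℕ} (S : PseudoSphereData n)

/-! ## The codifferential of the ambient space -/

theorem twoForm_eq_zero_of_finrank_le_one {V : Type*} [NormedAddCommGroup V] [NormedSpace ℝ V]
    [FiniteDimensional ℝ V] (hV : Module.finrank ℝ V ≤ 1) (α : V [⋀^Fin 2]→L[ℝ] ℝ)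
    (v : Fin 2 → V) : α v = 0 :=
  α.toAlternatingMap.map_linearDependent v fun h => by
    have := h.fintype_card_le_finrank
    simp at this
    omega

/-- The star has constant coefficients here, so it passes through the derivative. -/
theorem extDeriv_hodgeStar {V ι : Type*} [NormedAddCommGroup V] [NormedSpace ℝ V] [Fintype ι]
    [DecidableEq ι] (g : LinearMap.BilinForm ℝ V) (f : Module.Basis ι ℝ V) {k m d : ℕ}
    (h : k + m = d) (vol : V [⋀^Fin d]→L[ℝ] ℝ) (r : ℝ) {α : V → V [⋀^Fin k]→L[ℝ] ℝ} {y : V}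
    (hα : DifferentiableAt ℝ α y) :
    extDeriv (fun z => hodgeStar g f h vol (r • α z)) y =
      ContinuousAlternatingMap.alternatizeUncurryFin
        ((hodgeStarCLM g f h vol).comp (r • fderiv ℝ α y)) := by
  have h1 : (fun z => hodgeStar g f h vol (r • α z)) =
      fun z => hodgeStarCLM g f h vol (r • α z) := by
    funext z
    rw [hodgeStarCLM_apply]
  have h2 := (hodgeStarCLM g f h vol).hasFDerivAt.comp y (hα.hasFDerivAt.const_smul r)
  rw [h1, extDeriv]
  congr 1
  exact h2.fderiv

theorem ambientDelta_one_apply {α : (Fin (n + 1) → ℝ) → (Fin (n + 1) → ℝ) [⋀^Fin 1]→L[ℝ] ℝ}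
    {y : Fin (n + 1) → ℝ} (hα : DifferentiableAt ℝ α y) (w : Fin 0 → Fin (n + 1) → ℝ) :
    S.ambientDelta α y w = -∑ A, fderiv ℝ α y (Pi.basisFun ℝ _ A)
      (fun _ => dualVec S.η (Pi.basisFun ℝ _) A) := by
  rw [ambientDelta, dif_pos (by omega), extDeriv_hodgeStar _ _ _ _ _ hα,
    hodgeStarInv_alternatize_hodgeStar_one S.η S.η_comm _ S.gram_basisFun_det_ne_zero
      (Equiv.refl _) _ S.ambientVol_basisFun_sq _ _ ((-1 : ℝ) ^ (0 + 1) • fderiv ℝ α y) _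
      (fun u => hodgeStarCLM_apply _ _ _ _ _), ← Finset.sum_neg_distrib]
  refine Finset.sum_congr rfl fun A _ => ?_
  simp

theorem ambientDelta_two_apply {α : (Fin (n + 1) → ℝ) → (Fin (n + 1) → ℝ) [⋀^Fin 2]→L[ℝ] ℝ}
    {y : Fin (n + 1) → ℝ} (hα : DifferentiableAt ℝ α y) (w : Fin 1 → Fin (n + 1) → ℝ) :
    S.ambientDelta α y w = -∑ A, fderiv ℝ α y (Pi.basisFun ℝ _ A)
      ![dualVec S.η (Pi.basisFun ℝ _) A, w 0] := by
  by_cases hn : 1 + 1 ≤ n + 1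
  · rw [ambientDelta, dif_pos hn, extDeriv_hodgeStar _ _ _ _ _ hα,
      hodgeStarInv_alternatize_hodgeStar_two S.η S.η_comm _ S.gram_basisFun_det_ne_zero
        (Equiv.refl _) _ S.ambientVol_basisFun_sq _ _ ((-1 : ℝ) ^ (1 + 1) • fderiv ℝ α y) _
        (fun u => hodgeStarCLM_apply _ _ _ _ _)]
    congr 1
    refine Finset.sum_congr rfl fun A _ => ?_
    simp
  -- Here $n=0$: the default value of the codifferential matches the trace because a line carries no
  -- nonzero two-forms.
  · rw [ambientDelta, dif_neg hn, Finset.sum_eq_zero fun A _ =>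
      twoForm_eq_zero_of_finrank_le_one (by rw [Module.finrank_fin_fun]; omega) _ _, neg_zero]
    rfl

/-! ## The codifferential of the sphere -/

section SphereDelta

variable {k m : ℕ}

/-- The linear family of restrictions to the tangent space of the derivatives of `B`. -/
def tangentFDeriv (B : (Fin (n + 1) → ℝ) → (Fin (n + 1) → ℝ) [⋀^Fin k]→L[ℝ] ℝ) (p : S.sphere) :
    S.tangent p →L[ℝ] S.tangent p [⋀^Fin k]→L[ℝ] ℝ :=
  (ContinuousAlternatingMap.compContinuousLinearMapCLM (S.tangent p).subtypeL).comp
    ((fderiv ℝ B p).comp (S.tangent p).subtypeL)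

theorem tangentFDeriv_apply (B : (Fin (n + 1) → ℝ) → (Fin (n + 1) → ℝ) [⋀^Fin k]→L[ℝ] ℝ)
    (p : S.sphere) (u : S.tangent p) :
    S.tangentFDeriv B p u =
      (fderiv ℝ B p u).compContinuousLinearMap (S.tangent p).subtypeL := rfl

/-- The Hodge star of the sphere is a multiple of the Hodge star of the ambient space,
contracted with the position vector. -/
def StarRelation (h : k + m = n) (h' : k + (m + 1) = n + 1) (C : ℝ) : Prop :=
  ∀ (p : S.sphere) (α : (Fin (n + 1) → ℝ) [⋀^Fin k]→L[ℝ] ℝ) (w : Fin m → S.tangent p),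
    hodgeStar (S.sphereMetric p) (Module.finBasis ℝ (S.tangent p)) h (S.sphereVol p)
      (α.compContinuousLinearMap (S.tangent p).subtypeL) w =
    C * hodgeStar S.η (Pi.basisFun ℝ _) h' ambientVol α
      (Fin.cons (p : Fin (n + 1) → ℝ) fun i => (w i : Fin (n + 1) → ℝ))

/-- The Hodge star of `r • β` on the sphere. -/
def sphereStar (h : k + m = n) (r : ℝ) (β : S.SphereForm k) : S.SphereForm m := fun q =>
  hodgeStar (S.sphereMetric q) (Module.finBasis ℝ (S.tangent q)) h (S.sphereVol q)
    (r • (β q : S.tangent q [⋀^Fin k]→L[ℝ] ℝ))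

/-- The exponent collects $-m$ from the degree-zero extension of an $m$-form, $+k$ from rescaling
$\beta^{(0)}$ to the radial projection `q`, and $-1$ from $q=y/\rho$. Tangential projection of the
arguments is invisible because `q` already occupies the first slot. -/
theorem ext_sphereStar {h : k + m = n} {h' : k + (m + 1) = n + 1} {C : ℝ}
    (hS : S.StarRelation h h' C) (β : S.SphereForm k) (r : ℝ) {y : Fin (n + 1) → ℝ}
    (hy : y ∈ S.cone) :
    S.ext 0 (S.sphereStar h r β) y =
      (C * S.radius y ^ ((k : ℝ) - m - 1)) •
        (hodgeStar S.η (Pi.basisFun ℝ _) h' ambientVol (r • S.ext 0 β y)).curryLeft y := by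
  have h0 := S.radius_pos hy
  rw [S.ext_of_mem 0 (S.sphereStar h r β) hy]
  set q := S.radial y hy with hq
  have hqy : (q : Fin (n + 1) → ℝ) = (S.radius y)⁻¹ • y := rfl
  have hB : S.ext 0 β q = S.radius y ^ k • S.ext 0 β y := by
    rw [hqy, S.ext_zero_smul β hy (inv_pos.2 h0), inv_pow, inv_inv]
  have hβ : S.sphereStar h r β q = hodgeStar (S.sphereMetric q)
      (Module.finBasis ℝ (S.tangent q)) h (S.sphereVol q)
      ((r • S.ext 0 β q).compContinuousLinearMap (S.tangent q).subtypeL) := by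
    have : (S.ext 0 β q).compContinuousLinearMap (S.tangent q).subtypeL = β q :=
      congrFun (S.restr_ext 0 β) q
    rw [sphereStar, ← this]
    rfl
  ext w
  have h1 := (hodgeStar S.η (Pi.basisFun ℝ _) h' ambientVol (r • S.ext 0 β q)).curryLeft q
    |>.map_add_smul_of_annihilates (q : Fin (n + 1) → ℝ) (by
      intro w i
      cases m with
      | zero => exact i.elim0
      | succ m =>
        exact ContinuousAlternatingMap.update_eq_zero_of_curryLeft_eq_zero _ _
          (ContinuousAlternatingMap.curryLeft_same _ _) _ _) w
    (fun i => -((S.η q q)⁻¹ * S.η q (w i)))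
  simp only [ContinuousAlternatingMap.smul_apply,
    ContinuousAlternatingMap.compContinuousLinearMap_apply, smul_eq_mul]
  rw [hβ, hS]
  have h2 : (fun i => ((S.tangentProj q ∘ w) i : Fin (n + 1) → ℝ)) =
      fun i => w i + (-((S.η q q)⁻¹ * S.η q (w i))) • (q : Fin (n + 1) → ℝ) := by
    funext i
    rw [Function.comp_apply, coe_tangentProj, neg_smul, sub_eq_add_neg]
  rw [h2]
  have h3 : hodgeStar S.η (Pi.basisFun ℝ _) h' ambientVol (r • S.ext 0 β q)
      (Fin.cons (q : Fin (n + 1) → ℝ)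
        fun i => w i + (-((S.η q q)⁻¹ * S.η q (w i))) • (q : Fin (n + 1) → ℝ)) =
      (hodgeStar S.η (Pi.basisFun ℝ _) h' ambientVol (r • S.ext 0 β q)).curryLeft q w := h1
  rw [h3, hB, smul_comm r, hodgeStar_smul, hqy, map_smul,
    ContinuousAlternatingMap.curryLeft_smul]
  simp only [ContinuousAlternatingMap.smul_apply, _root_.smul_apply, smul_eq_mul]
  have h4 : S.radius y ^ ((k : ℝ) - m - 1) =
      S.radius y ^ ((0 : ℝ) - m) * S.radius y ^ k * (S.radius y)⁻¹ := by
    rw [← Real.rpow_natCast, ← Real.rpow_neg_one, ← Real.rpow_add h0, ← Real.rpow_add h0]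
    congr 1
    ring
  rw [h4]
  ring

/-- Of the three terms of the product rule, the derivative of the power of $\rho$ vanishes along
$\Sigma_n$. The derivative of the position vector alternates to a multiple of the ambient star on
tangent vectors, zero by `hT`. What is left is the star of the tangential derivative, as if the star
were constant. -/
theorem sphereD_sphereStar {h : k + m = n} {h' : k + (m + 1) = n + 1} {C : ℝ}
    (hS : S.StarRelation h h' C) (β : S.SphereForm k) (r : ℝ) (p : S.sphere)
    (hB : DifferentiableAt ℝ (S.ext 0 β) p)
    (hT : ∀ w : Fin (m + 1) → S.tangent p, hodgeStar S.η (Pi.basisFun ℝ _) h' ambientVol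
      (r • S.ext 0 β p) (fun i => (w i : Fin (n + 1) → ℝ)) = 0) :
    S.sphereD (S.sphereStar h r β) p =
      ContinuousAlternatingMap.alternatizeUncurryFin
        ((hodgeStarCLM (S.sphereMetric p) (Module.finBasis ℝ (S.tangent p)) h
          (S.sphereVol p)).comp (r • S.tangentFDeriv (S.ext 0 β) p)) := by
  have hp := S.sphere_subset_cone p
  set B := S.ext 0 β with hBdef
  set G := hodgeStarCLM S.η (Pi.basisFun ℝ (Fin (n + 1))) h' ambientVol with hG
  have h1 : S.ext 0 (S.sphereStar h r β) =ᶠ[nhds (p : Fin (n + 1) → ℝ)]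
      fun y => (C * S.radius y ^ ((k : ℝ) - m - 1)) • (G (r • B y)).curryLeft y := by
    refine Filter.eventuallyEq_of_mem (S.cone_mem_nhds hp) fun y hy => ?_
    rw [S.ext_sphereStar hS β r hy, hG, hodgeStarCLM_apply]
  have hGB : HasFDerivAt (fun y => G (r • B y)) (G.comp (r • fderiv ℝ B p))
      (p : Fin (n + 1) → ℝ) :=
    G.hasFDerivAt.comp (p : Fin (n + 1) → ℝ) (hB.hasFDerivAt.const_smul r)
  obtain ⟨T, hT1, hT2⟩ := hasFDerivAt_curryLeft_self hGB
  have h3 := (((S.hasFDerivAt_radius_rpow hp ((k : ℝ) - m - 1)).const_mul C).fun_smul hT1).fderiv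
  have h4 : ∀ (u : S.tangent p) (x : Fin m → Fin (n + 1) → ℝ),
      fderiv ℝ (fun y => (C * S.radius y ^ ((k : ℝ) - m - 1)) • (G (r • B y)).curryLeft y) p u x =
        C * (G (r • B p) (Fin.cons (u : Fin (n + 1) → ℝ) x) +
          G (r • fderiv ℝ B p u) (Fin.cons (p : Fin (n + 1) → ℝ) x)) := by
    intro u x
    have h5 : (C • (-S.ε * S.H ^ 2 * ((k : ℝ) - m - 1) * S.radius p ^ ((k : ℝ) - m - 1 - 2)) •
        S.ηL p) (u : Fin (n + 1) → ℝ) = 0 := by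
      change C * (_ * S.η p u) = 0
      rw [S.η_tangent, mul_zero, mul_zero]
    rw [h3, add_apply, ContinuousLinearMap.smulRight_apply, h5, zero_smul, add_zero,
      _root_.smul_apply, hT2, S.radius_sphere, Real.one_rpow, mul_one]
    rfl
  ext v
  have h5 : S.sphereD (S.sphereStar h r β) p v = extDeriv (S.ext 0 (S.sphereStar h r β)) p
        (fun i => (v i : Fin (n + 1) → ℝ)) := rfl
  rw [h5, h1.extDeriv_eq, extDeriv, alternatizeUncurryFin_apply_real,
    alternatizeUncurryFin_apply_real]
  have h6 := alternatizeUncurryFin_curryLeft_sum (G (r • B p))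
    (fun i => (v i : Fin (n + 1) → ℝ))
  rw [hG, hodgeStarCLM_apply, hT, mul_zero] at h6
  have h7 : ∀ i, C * hodgeStar S.η (Pi.basisFun ℝ _) h' ambientVol (r • fderiv ℝ B p (v i))
      (Fin.cons (p : Fin (n + 1) → ℝ) (i.removeNth fun i => (v i : Fin (n + 1) → ℝ))) =
      hodgeStar (S.sphereMetric p) (Module.finBasis ℝ (S.tangent p)) h (S.sphereVol p)
        (r • S.tangentFDeriv B p (v i)) (i.removeNth v) := fun i =>
    (hS p (r • fderiv ℝ B p (v i)) (i.removeNth v)).symm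
  have e1 : ∀ i : Fin (m + 1), (-1 : ℝ) ^ (i : ℕ) *
      fderiv ℝ (fun y => (C * S.radius y ^ ((k : ℝ) - m - 1)) • (G (r • B y)).curryLeft y) p (v i)
        (i.removeNth fun i => (v i : Fin (n + 1) → ℝ)) =
      C * ((-1) ^ (i : ℕ) * G (r • B p) (Fin.cons (v i : Fin (n + 1) → ℝ)
        (i.removeNth fun i => (v i : Fin (n + 1) → ℝ)))) +
      (-1) ^ (i : ℕ) * ((hodgeStarCLM (S.sphereMetric p) (Module.finBasis ℝ (S.tangent p)) h
        (S.sphereVol p)).comp (r • S.tangentFDeriv B p)) (v i) (i.removeNth v) := by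
    intro i
    have e2 : ((hodgeStarCLM (S.sphereMetric p) (Module.finBasis ℝ (S.tangent p)) h
        (S.sphereVol p)).comp (r • S.tangentFDeriv B p)) (v i) (i.removeNth v) =
        C * G (r • fderiv ℝ B p (v i)) (Fin.cons (p : Fin (n + 1) → ℝ)
          (i.removeNth fun i => (v i : Fin (n + 1) → ℝ))) := by
      rw [hG, hodgeStarCLM_apply, h7]
      exact congrArg (fun A : S.tangent p [⋀^Fin m]→L[ℝ] ℝ => A (i.removeNth v))
        (hodgeStarCLM_apply _ _ _ _ _)
    rw [h4, e2]
    ring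
  rw [Finset.sum_congr rfl fun i _ => e1 i, Finset.sum_add_distrib, ← Finset.mul_sum]
  refine add_eq_right.2 ?_
  rw [show (0 : ℝ) = C * 0 by rw [mul_zero], ← h6, hG, hodgeStarCLM_apply]

theorem sphereDelta_of_le (β : S.SphereForm (k + 1)) (h : k + 1 ≤ n) (p : S.sphere) :
    S.sphereDelta β p = hodgeStarInv (S.sphereMetric p) (Module.finBasis ℝ (S.tangent p))
      (q := n - (k + 1) + 1) (by omega) (S.sphereVol p)
      (S.sphereD (S.sphereStar (m := n - (k + 1)) (by omega) ((-1) ^ (k + 1)) β) p) :=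
  congrFun (dif_pos h : S.sphereDelta β = _) p

theorem sphereDelta_of_not_le (β : S.SphereForm (k + 1)) (h : ¬k + 1 ≤ n) (p : S.sphere) :
    S.sphereDelta β p = (0 : S.tangent p [⋀^Fin k]→L[ℝ] ℝ) :=
  congrFun (dif_neg h : S.sphereDelta β = _) p

end SphereDelta

theorem starRelation_one {m : ℕ} (h : 1 + m = n) (h' : 1 + (m + 1) = n + 1) :
    S.StarRelation h h' ((-1) ^ (n + 1) * S.H) := fun p α w =>
  S.sphere_hodgeStar_one p _ (S.tangentEquiv p) h h' α w

theorem starRelation_two {m : ℕ} (h : 2 + m = n) (h' : 2 + (m + 1) = n + 1) :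
    S.StarRelation h h' ((-1) ^ (n + 2) * S.H) := fun p α w =>
  S.sphere_hodgeStar_two p _ (S.tangentEquiv p) h h' α w

/-! ### The codifferential of the sphere as a trace -/

section StarInv

variable {ι : Type*} [Fintype ι] [DecidableEq ι] (p : S.sphere)
  (f : Module.Basis ι ℝ (S.tangent p)) {m : ℕ}

theorem sphere_hodgeStarInv_one (e : Fin n ≃ ι) (h : 1 + m = n) (h' : m + 1 + 0 = n)
    (L : S.tangent p →L[ℝ] S.tangent p [⋀^Fin 1]→L[ℝ] ℝ) (w : Fin 0 → S.tangent p) :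
    hodgeStarInv (S.sphereMetric p) f h' (S.sphereVol p)
      (ContinuousAlternatingMap.alternatizeUncurryFin
        ((hodgeStarCLM (S.sphereMetric p) f h (S.sphereVol p)).comp L)) w =
      ∑ c, L (f c) (fun _ => dualVec (S.sphereMetric p) f c) :=
  hodgeStarInv_alternatize_hodgeStar_one (S.sphereMetric p) (fun u v => S.η_comm u v) f
    (S.gram_tangent_det_ne_zero p f e) e (S.sphereVol p) (S.sphereVol_sq p f e) h h' L _
    (fun _ => hodgeStarCLM_apply _ _ _ _ _) w

theorem sphere_hodgeStarInv_two (e : Fin n ≃ ι) (h : 2 + m = n) (h' : m + 1 + 1 = n)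
    (L : S.tangent p →L[ℝ] S.tangent p [⋀^Fin 2]→L[ℝ] ℝ) (w : Fin 1 → S.tangent p) :
    hodgeStarInv (S.sphereMetric p) f h' (S.sphereVol p)
      (ContinuousAlternatingMap.alternatizeUncurryFin
        ((hodgeStarCLM (S.sphereMetric p) f h (S.sphereVol p)).comp L)) w =
      -∑ c, L (f c) ![dualVec (S.sphereMetric p) f c, w 0] :=
  hodgeStarInv_alternatize_hodgeStar_two (S.sphereMetric p) (fun u v => S.η_comm u v) f
    (S.gram_tangent_det_ne_zero p f e) e (S.sphereVol p) (S.sphereVol_sq p f e) h h' L _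
    (fun _ => hodgeStarCLM_apply _ _ _ _ _) w

end StarInv

theorem curryLeft_smul_ext_zero {k : ℕ} (β : S.SphereForm (k + 1)) (r : ℝ) (p : S.sphere) :
    (r • S.ext 0 β p).curryLeft (p : Fin (n + 1) → ℝ) = 0 := by
  rw [ContinuousAlternatingMap.curryLeft_smul, _root_.smul_apply,
    S.curryLeft_ext 0 β (S.sphere_subset_cone p), smul_zero]

theorem sphereDelta_one_apply (β : S.SphereForm 1) (p : S.sphere)
    (hB : DifferentiableAt ℝ (S.ext 0 β) p) (w : Fin 0 → S.tangent p) :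
    S.sphereDelta β p w = -∑ c, fderiv ℝ (S.ext 0 β) p (Module.finBasis ℝ (S.tangent p) c)
      (fun _ => (dualVec (S.sphereMetric p) (Module.finBasis ℝ (S.tangent p)) c :
        S.tangent p)) := by
  by_cases hn : 0 + 1 ≤ n
  · have h1 := S.sphereD_sphereStar (S.starRelation_one (m := n - (0 + 1)) (by omega) (by omega))
      β ((-1) ^ (0 + 1)) p hB
      (S.ambient_hodgeStar_one_tangent p (by omega) _ (S.curryLeft_smul_ext_zero β _ p))
    refine (congrArg (fun A : S.tangent p [⋀^Fin 0]→L[ℝ] ℝ => A w)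
      (S.sphereDelta_of_le β hn p)).trans ?_
    rw [h1, S.sphere_hodgeStarInv_one p _ (S.tangentEquiv p), ← Finset.sum_neg_distrib]
    refine Finset.sum_congr rfl fun A _ => ?_
    rw [zero_add, pow_one]
    exact neg_one_mul _
  -- Here $n=0$: the tangent space is zero and the trace is an empty sum.
  · rw [Finset.sum_eq_zero, neg_zero]
    · exact congrArg (fun A : S.tangent p [⋀^Fin 0]→L[ℝ] ℝ => A w)
        (S.sphereDelta_of_not_le β hn p)
    · intro c _
      exact absurd ((S.tangentEquiv p).symm c).2 (by omega)

theorem sphereDelta_two_apply (β : S.SphereForm 2) (p : S.sphere)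
    (hB : DifferentiableAt ℝ (S.ext 0 β) p) (w : Fin 1 → S.tangent p) :
    S.sphereDelta β p w = -∑ c, fderiv ℝ (S.ext 0 β) p (Module.finBasis ℝ (S.tangent p) c)
      ![((dualVec (S.sphereMetric p) (Module.finBasis ℝ (S.tangent p)) c :
        S.tangent p) : Fin (n + 1) → ℝ), (w 0 : Fin (n + 1) → ℝ)] := by
  have hL : ∀ c, S.tangentFDeriv (S.ext 0 β) p (Module.finBasis ℝ (S.tangent p) c)
      ![dualVec (S.sphereMetric p) (Module.finBasis ℝ (S.tangent p)) c, w 0] =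
      fderiv ℝ (S.ext 0 β) p (Module.finBasis ℝ (S.tangent p) c)
      ![((dualVec (S.sphereMetric p) (Module.finBasis ℝ (S.tangent p)) c :
        S.tangent p) : Fin (n + 1) → ℝ), (w 0 : Fin (n + 1) → ℝ)] := by
    intro c
    rw [tangentFDeriv_apply, ContinuousAlternatingMap.compContinuousLinearMap_apply]
    congr 1
    funext i
    fin_cases i <;> rfl
  simp only [← hL]
  by_cases hn : 1 + 1 ≤ n
  · have h1 := S.sphereD_sphereStar (S.starRelation_two (m := n - (1 + 1)) (by omega) (by omega))
      β ((-1) ^ (1 + 1)) p hB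
      (S.ambient_hodgeStar_two_tangent p (by omega) _ (S.curryLeft_smul_ext_zero β _ p))
    refine (congrArg (fun A : S.tangent p [⋀^Fin 1]→L[ℝ] ℝ => A w)
      (S.sphereDelta_of_le β hn p)).trans ?_
    rw [h1, S.sphere_hodgeStarInv_two p _ (S.tangentEquiv p)]
    congr 1
    refine Finset.sum_congr rfl fun A _ => ?_
    rw [show ((-1 : ℝ) ^ (1 + 1)) = 1 by norm_num]
    exact one_mul _
  · rw [Finset.sum_eq_zero fun A _ =>
      twoForm_eq_zero_of_finrank_le_one (by rw [S.finrank_tangent]; omega) _ _, neg_zero]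
    exact congrArg (fun A : S.tangent p [⋀^Fin 1]→L[ℝ] ℝ => A w)
      (S.sphereDelta_of_not_le β hn p)

end PseudoSphereData

end

noncomputable section

namespace PseudoSphereData

variable {n : ℕ} (S : PseudoSphereData n)

/-! ## The Laplace-de Rham operator of the ambient space on one-forms -/

/-- Minus the `η`-divergence of a one-form. -/
def ambientDiv (α : (Fin (n + 1) → ℝ) → (Fin (n + 1) → ℝ) [⋀^Fin 1]→L[ℝ] ℝ)
    (y : Fin (n + 1) → ℝ) : ℝ :=
  -∑ A, fderiv ℝ α y (Pi.basisFun ℝ _ A) (fun _ => dualVec S.η (Pi.basisFun ℝ _) A)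

theorem hasFDerivAt_fderiv_apply_apply {V : Type*} [NormedAddCommGroup V] [NormedSpace ℝ V]
    {k : ℕ} {α : V → V [⋀^Fin k]→L[ℝ] ℝ} {y : V} (hα : ContDiffAt ℝ 2 α y) (u : V)
    (v : Fin k → V) :
    HasFDerivAt (fun z => fderiv ℝ α z u v)
      ((ContinuousAlternatingMap.apply ℝ V ℝ v).comp ((fderiv ℝ (fderiv ℝ α) y).flip u)) y := by
  have h1 : DifferentiableAt ℝ (fderiv ℝ α) y :=
    (hα.fderiv_right (m := 1) (by norm_num)).differentiableAt (by norm_num)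
  have h2 := h1.hasFDerivAt.clm_apply (hasFDerivAt_const u y)
  have h3 := (ContinuousAlternatingMap.apply ℝ V ℝ v).hasFDerivAt.comp y h2
  refine h3.congr_fderiv ?_
  ext w
  simp

theorem differentiableAt_ambientDiv
    {α : (Fin (n + 1) → ℝ) → (Fin (n + 1) → ℝ) [⋀^Fin 1]→L[ℝ] ℝ} {y : Fin (n + 1) → ℝ}
    (hα : ContDiffAt ℝ 2 α y) : DifferentiableAt ℝ (S.ambientDiv α) y :=
  (HasFDerivAt.fun_sum fun _ _ => hasFDerivAt_fderiv_apply_apply hα _ _).neg.differentiableAt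

theorem fderiv_ambientDiv {α : (Fin (n + 1) → ℝ) → (Fin (n + 1) → ℝ) [⋀^Fin 1]→L[ℝ] ℝ}
    {y : Fin (n + 1) → ℝ} (hα : ContDiffAt ℝ 2 α y) (u : Fin (n + 1) → ℝ) :
    fderiv ℝ (S.ambientDiv α) y u = -∑ A, fderiv ℝ (fderiv ℝ α) y u (Pi.basisFun ℝ _ A)
      (fun _ => dualVec S.η (Pi.basisFun ℝ _) A) := by
  have h : HasFDerivAt (S.ambientDiv α) _ y :=
    (HasFDerivAt.fun_sum fun A (_ : A ∈ Finset.univ) =>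
      hasFDerivAt_fderiv_apply_apply hα (Pi.basisFun ℝ _ A)
        (fun _ => dualVec S.η (Pi.basisFun ℝ _) A)).neg
  rw [h.fderiv]
  simp

theorem ambientDelta_eq_constOfIsEmpty
    {α : (Fin (n + 1) → ℝ) → (Fin (n + 1) → ℝ) [⋀^Fin 1]→L[ℝ] ℝ} {y : Fin (n + 1) → ℝ}
    (hα : DifferentiableAt ℝ α y) :
    S.ambientDelta α y =
      ContinuousAlternatingMap.constOfIsEmpty ℝ (Fin (n + 1) → ℝ) (Fin 0) (S.ambientDiv α y) := by
  ext w
  exact S.ambientDelta_one_apply hα w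

theorem extDeriv_ambientDelta {α : (Fin (n + 1) → ℝ) → (Fin (n + 1) → ℝ) [⋀^Fin 1]→L[ℝ] ℝ}
    {y : Fin (n + 1) → ℝ} (hα : ContDiffAt ℝ 2 α y) (w : Fin 1 → Fin (n + 1) → ℝ) :
    extDeriv (S.ambientDelta α) y w = fderiv ℝ (S.ambientDiv α) y (w 0) := by
  have h1 : S.ambientDelta α =ᶠ[nhds y] fun z =>
      ContinuousAlternatingMap.constOfIsEmpty ℝ (Fin (n + 1) → ℝ) (Fin 0) (S.ambientDiv α z) :=
    (hα.eventually (by simp)).mono fun z hz =>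
      S.ambientDelta_eq_constOfIsEmpty (hz.differentiableAt (by norm_num))
  rw [h1.extDeriv_eq, extDeriv_constOfIsEmpty]
  rfl

theorem hasFDerivAt_extDeriv {V : Type*} [NormedAddCommGroup V] [NormedSpace ℝ V]
    {k : ℕ} {α : V → V [⋀^Fin k]→L[ℝ] ℝ} {y : V} (hα : ContDiffAt ℝ 2 α y) :
    HasFDerivAt (extDeriv α) ((ContinuousAlternatingMap.alternatizeUncurryFinCLM ℝ V ℝ).comp
      (fderiv ℝ (fderiv ℝ α) y)) y := by
  have h1 : DifferentiableAt ℝ (fderiv ℝ α) y :=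
    (hα.fderiv_right (m := 1) (by norm_num)).differentiableAt (by norm_num)
  have h2 := (ContinuousAlternatingMap.alternatizeUncurryFinCLM ℝ V ℝ (n := k)).hasFDerivAt
    (x := fderiv ℝ α y)
  exact @HasFDerivAt.comp ℝ _ V _ _ (V →L[ℝ] V [⋀^Fin k]→L[ℝ] ℝ) _ _
    (V [⋀^Fin (k + 1)]→L[ℝ] ℝ) _ _ _ _ y _ _ h2 h1.hasFDerivAt

theorem alternatizeUncurryFin_one_apply {V : Type*} [NormedAddCommGroup V] [NormedSpace ℝ V]
    (M : V →L[ℝ] V [⋀^Fin 1]→L[ℝ] ℝ) (u v : V) :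
    ContinuousAlternatingMap.alternatizeUncurryFin M ![u, v] =
      M u (fun _ => v) - M v (fun _ => u) := by
  rw [alternatizeUncurryFin_apply_real, Fin.sum_univ_two]
  have h0 : (0 : Fin 2).removeNth ![u, v] = fun _ => v := by
    funext i; fin_cases i; rfl
  have h1 : (1 : Fin 2).removeNth ![u, v] = fun _ => u := by
    funext i; fin_cases i; rfl
  rw [h0, h1]
  simp [sub_eq_add_neg]

/-- The mixed second derivatives in $d\delta$ and $\delta d$ cancel by symmetry, leaving the
Laplacian of each Cartesian component. -/
theorem ambientBox_apply {α : (Fin (n + 1) → ℝ) → (Fin (n + 1) → ℝ) [⋀^Fin 1]→L[ℝ] ℝ}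
    {y : Fin (n + 1) → ℝ} (hα : ContDiffAt ℝ 2 α y) (w : Fin 1 → Fin (n + 1) → ℝ) :
    S.ambientBox α y w = ∑ A, fderiv ℝ (fderiv ℝ α) y (Pi.basisFun ℝ _ A)
      (dualVec S.η (Pi.basisFun ℝ _) A) w := by
  have hsymm : IsSymmSndFDerivAt ℝ α y := hα.isSymmSndFDerivAt (by simp)
  have hE := hasFDerivAt_extDeriv hα
  have hw : w = fun _ => w 0 := funext fun i => congrArg w (Subsingleton.elim i 0)
  change -(extDeriv (S.ambientDelta α) y w + S.ambientDelta (extDeriv α) y w) = _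
  rw [S.extDeriv_ambientDelta hα, S.fderiv_ambientDiv hα,
    S.ambientDelta_two_apply hE.differentiableAt, hE.fderiv, neg_add, neg_neg, neg_neg,
    ← Finset.sum_add_distrib]
  refine Finset.sum_congr rfl fun A _ => ?_
  rw [ContinuousLinearMap.comp_apply, ContinuousAlternatingMap.alternatizeUncurryFinCLM_apply,
    alternatizeUncurryFin_one_apply, hsymm.eq (w 0), ← hw]
  ring

/-! ## The Laplace-de Rham operators agree on transverse extensions of degree zero -/

variable {S}

theorem IsSmooth.contDiffAt {k : ℕ} {b : S.SphereForm k} (hb : S.IsSmooth b)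
    {y : Fin (n + 1) → ℝ} (hy : y ∈ S.cone) : ContDiffAt ℝ ∞ (S.ext 0 b) y :=
  ContDiffOn.contDiffAt hb (S.cone_mem_nhds hy)

theorem IsSmooth.contDiffAt_two {k : ℕ} {b : S.SphereForm k} (hb : S.IsSmooth b)
    {y : Fin (n + 1) → ℝ} (hy : y ∈ S.cone) : ContDiffAt ℝ 2 (S.ext 0 b) y :=
  (hb.contDiffAt hy).of_le (WithTop.coe_le_coe.2 le_top)

theorem IsSmooth.differentiableAt {k : ℕ} {b : S.SphereForm k} (hb : S.IsSmooth b)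
    {y : Fin (n + 1) → ℝ} (hy : y ∈ S.cone) : DifferentiableAt ℝ (S.ext 0 b) y :=
  (hb.contDiffAt hy).differentiableAt (by simp)

variable {b : S.SphereForm 1}

theorem ext_apply_self (s : ℝ) (b : S.SphereForm 1) {y : Fin (n + 1) → ℝ} (hy : y ∈ S.cone) :
    S.ext s b y (fun _ => y) = 0 := by
  have h := congrArg (fun A => A ![]) (S.curryLeft_ext s b hy)
  rw [show (fun _ : Fin 1 => y) = Matrix.vecCons y ![] by funext i; fin_cases i; rfl]
  exact h

theorem IsSmooth.fderiv_ext_self (hb : S.IsSmooth b) {y : Fin (n + 1) → ℝ} (hy : y ∈ S.cone) :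
    fderiv ℝ (S.ext 0 b) y y = -S.ext 0 b y := by
  rw [(isHomogeneousNeg_ext b).fderiv_self hy (hb.differentiableAt hy), Nat.cast_one, neg_one_smul]

/-- Differentiate the identity $i_D b^{(0)}=0$. -/
theorem IsSmooth.fderiv_ext_apply_self (hb : S.IsSmooth b) {y : Fin (n + 1) → ℝ} (hy : y ∈ S.cone)
    (u : Fin (n + 1) → ℝ) :
    fderiv ℝ (S.ext 0 b) y u (fun _ => y) = -S.ext 0 b y (fun _ => u) := by
  obtain ⟨T, hT1, hT2⟩ := hasFDerivAt_curryLeft_self (hb.differentiableAt hy).hasFDerivAt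
  have h1 : (fun z => (S.ext 0 b z).curryLeft z) =ᶠ[nhds y] fun _ => 0 :=
    Filter.eventuallyEq_of_mem (S.cone_mem_nhds hy) fun z hz => S.curryLeft_ext 0 b hz
  have h2 : T = 0 := hT1.unique ((hasFDerivAt_const _ y).congr_of_eventuallyEq h1)
  have h3 := congrArg (fun A => A ![]) (hT2 u)
  rw [h2] at h3
  have h4 : (0 : ℝ) = S.ext 0 b y (Matrix.vecCons u ![]) +
    fderiv ℝ (S.ext 0 b) y u (Matrix.vecCons y ![]) := h3
  rw [show (fun _ : Fin 1 => y) = Matrix.vecCons y ![] by funext i; fin_cases i; rfl,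
    show (fun _ : Fin 1 => u) = Matrix.vecCons u ![] by funext i; fin_cases i; rfl]
  linarith

/-- The two traces differ by the radial entry, which is a multiple of $b^{(0)}_p(p)=0$. -/
theorem IsSmooth.sphereDelta_apply (hb : S.IsSmooth b) (p : S.sphere) (w : Fin 0 → S.tangent p) :
    S.sphereDelta b p w = S.ambientDiv (S.ext 0 b) p := by
  have hp := S.sphere_subset_cone p
  have h := S.sum_basisFun_eq_tangent_add p (Module.finBasis ℝ (S.tangent p)) (S.tangentEquiv p)
    (bilinOfOneForms (fderiv ℝ (S.ext 0 b) p))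
  have h0 : bilinOfOneForms (fderiv ℝ (S.ext 0 b) p) p p = 0 := by
    change fderiv ℝ (S.ext 0 b) p p (fun _ => (p : Fin (n + 1) → ℝ)) = 0
    rw [hb.fderiv_ext_apply_self hp, ext_apply_self 0 b hp, neg_zero]
  rw [h0, mul_zero, add_zero] at h
  exact (S.sphereDelta_one_apply b p (hb.differentiableAt hp) w).trans (congrArg Neg.neg h.symm)

/-- The ambient divergence has degree $-2$, while a function on $\Sigma_n$ is extended with degree
$0$; this accounts for $\rho^2$. On tangent vectors the factor is harmless, since $\rho=1$ and
$d\rho=0$ along $\Sigma_n$. -/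
theorem IsSmooth.ext_sphereDelta (hb : S.IsSmooth b) {y : Fin (n + 1) → ℝ} (hy : y ∈ S.cone) :
    S.ext 0 (S.sphereDelta b) y =
      ContinuousAlternatingMap.constOfIsEmpty ℝ (Fin (n + 1) → ℝ) (Fin 0)
        (S.radius y ^ (2 : ℝ) * S.ambientDiv (S.ext 0 b) y) := by
  have h0 := S.radius_pos hy
  ext w
  rw [S.ext_zero_of_mem _ hy, pow_zero, inv_one, one_smul]
  refine (hb.sphereDelta_apply (S.radial y hy) _).trans ?_
  have h1 : fderiv ℝ (S.ext 0 b) (S.radial y hy : Fin (n + 1) → ℝ) =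
      S.radius y ^ (2 : ℝ) • fderiv ℝ (S.ext 0 b) y := by
    refine ((isHomogeneousNeg_ext b).fderiv y hy _ (inv_pos.2 h0)).trans ?_
    rw [inv_pow, inv_inv]
    congr 1
    exact_mod_cast (Real.rpow_natCast (S.radius y) 2).symm
  rw [ambientDiv, h1]
  simp [ambientDiv, Finset.mul_sum]

theorem IsSmooth.sphereD_sphereDelta (hb : S.IsSmooth b) (p : S.sphere) (w : Fin 1 → S.tangent p) :
    S.sphereD (S.sphereDelta b) p w =
      extDeriv (S.ambientDelta (S.ext 0 b)) p (fun i => (w i : Fin (n + 1) → ℝ)) := by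
  have hp := S.sphere_subset_cone p
  have h1 : S.ext 0 (S.sphereDelta b) =ᶠ[nhds (p : Fin (n + 1) → ℝ)] fun y =>
      ContinuousAlternatingMap.constOfIsEmpty ℝ (Fin (n + 1) → ℝ) (Fin 0)
        (S.radius y ^ (2 : ℝ) * S.ambientDiv (S.ext 0 b) y) :=
    Filter.eventuallyEq_of_mem (S.cone_mem_nhds hp) fun y hy => hb.ext_sphereDelta hy
  have h2 := (S.hasFDerivAt_radius_rpow hp 2).mul
    (S.differentiableAt_ambientDiv (hb.contDiffAt_two hp)).hasFDerivAt
  change extDeriv (S.ext 0 (S.sphereDelta b)) p (fun i => (w i : Fin (n + 1) → ℝ)) = _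
  rw [h1.extDeriv_eq, extDeriv_constOfIsEmpty, S.extDeriv_ambientDelta (hb.contDiffAt_two hp)]
  change fderiv ℝ (fun y => S.radius y ^ (2 : ℝ) * S.ambientDiv (S.ext 0 b) y) p (w 0) = _
  have h3 := h2.fderiv
  have h4 : S.ηL p (w 0 : Fin (n + 1) → ℝ) = 0 := S.η_tangent p (w 0)
  refine (congrArg (fun A => A (w 0 : Fin (n + 1) → ℝ)) h3).trans ?_
  simp only [add_apply, smul_apply, h4, S.radius_sphere, Real.one_rpow, smul_zero, one_smul,
    add_zero]

/-- This is Cartan's formula $i_Dd=\mathcal L_D-d\,i_D$: degree zero kills the first term and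
transversality the second. In Cartesian components, Euler's relation and the derivative of
$i_Db^{(0)}=0$ give two equal terms that cancel. -/
theorem IsSmooth.curryLeft_extDeriv_ext (hb : S.IsSmooth b) {y : Fin (n + 1) → ℝ} (hy : y ∈ S.cone) :
    (extDeriv (S.ext 0 b) y).curryLeft y = 0 := by
  ext w
  have hw : w = fun _ => w 0 := funext fun i => congrArg w (Subsingleton.elim i 0)
  have h := alternatizeUncurryFin_one_apply (fderiv ℝ (S.ext 0 b) y) y (w 0)
  rw [hb.fderiv_ext_self hy, hb.fderiv_ext_apply_self hy] at h
  change extDeriv (S.ext 0 b) y (Matrix.vecCons y w) = 0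
  rw [show Matrix.vecCons y w = ![y, w 0] by funext i; fin_cases i <;> rfl]
  refine h.trans ?_
  rw [ContinuousAlternatingMap.neg_apply, sub_self]

theorem IsSmooth.ext_sphereD (hb : S.IsSmooth b) {y : Fin (n + 1) → ℝ} (hy : y ∈ S.cone) :
    S.ext 0 (S.sphereD b) y = extDeriv (S.ext 0 b) y :=
  S.ext_zero_restr _ (isHomogeneousNeg_ext b).extDeriv
    (fun _ hz => hb.curryLeft_extDeriv_ext hz) hy

theorem IsSmooth.sphereDelta_sphereD (hb : S.IsSmooth b) (p : S.sphere) (w : Fin 1 → S.tangent p) :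
    S.sphereDelta (S.sphereD b) p w =
      S.ambientDelta (extDeriv (S.ext 0 b)) p (fun i => (w i : Fin (n + 1) → ℝ)) := by
  have hp := S.sphere_subset_cone p
  have h1 : S.ext 0 (S.sphereD b) =ᶠ[nhds (p : Fin (n + 1) → ℝ)] extDeriv (S.ext 0 b) :=
    Filter.eventuallyEq_of_mem (S.cone_mem_nhds hp) fun y hy => hb.ext_sphereD hy
  have hE := (hasFDerivAt_extDeriv (hb.contDiffAt_two hp)).differentiableAt
  have h := S.sum_basisFun_eq_tangent_add p (Module.finBasis ℝ (S.tangent p)) (S.tangentEquiv p)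
    (bilinOfTwoForms (fderiv ℝ (extDeriv (S.ext 0 b)) p) (w 0))
  -- By Euler's relation the radial derivative of $db^{(0)}$ is a multiple of $db^{(0)}$, which `p`
  -- annihilates.
  have h0 : bilinOfTwoForms (fderiv ℝ (extDeriv (S.ext 0 b)) p) (w 0 : Fin (n + 1) → ℝ) p p = 0 := by
    change fderiv ℝ (extDeriv (S.ext 0 b)) p p ![(p : Fin (n + 1) → ℝ), w 0] = 0
    have h2 : extDeriv (S.ext 0 b) p ![(p : Fin (n + 1) → ℝ), w 0] = 0 :=
      congrArg (fun A => A ![(w 0 : Fin (n + 1) → ℝ)]) (hb.curryLeft_extDeriv_ext hp)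
    rw [(isHomogeneousNeg_ext b).extDeriv.fderiv_self hp hE, ContinuousAlternatingMap.smul_apply,
      h2, smul_zero]
  rw [h0, mul_zero, add_zero] at h
  refine (S.sphereDelta_two_apply _ p (hE.congr_of_eventuallyEq h1) w).trans ?_
  rw [S.ambientDelta_two_apply hE, h1.fderiv_eq]
  exact congrArg Neg.neg h.symm

/-- Equivalently, the additional term of a degree-zero transverse extension vanishes. -/
theorem IsSmooth.sphereBox_apply (hb : S.IsSmooth b) (p : S.sphere) (w : Fin 1 → S.tangent p) :
    S.sphereBox b p w = S.ambientBox (S.ext 0 b) p (fun i => (w i : Fin (n + 1) → ℝ)) :=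
  congrArg Neg.neg (congrArg₂ (· + ·) (hb.sphereD_sphereDelta p w) (hb.sphereDelta_sphereD p w))

end PseudoSphereData

end

noncomputable section

namespace PseudoSphereData

variable {n : ℕ} (S : PseudoSphereData n)

/-! ## Linearity of the Laplace-de Rham operator -/

theorem ambientBox_fun_sub {α β : (Fin (n + 1) → ℝ) → (Fin (n + 1) → ℝ) [⋀^Fin 1]→L[ℝ] ℝ}
    {y : Fin (n + 1) → ℝ} (hα : ContDiffAt ℝ 2 α y) (hβ : ContDiffAt ℝ 2 β y) :
    S.ambientBox (fun z => α z - β z) y = S.ambientBox α y - S.ambientBox β y := by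
  ext w
  have h : ∀ u v, fderiv ℝ (fderiv ℝ fun z => α z - β z) y u v w =
      fderiv ℝ (fderiv ℝ α) y u v w - fderiv ℝ (fderiv ℝ β) y u v w := by
    intro u v
    have h1 : (fun z => fderiv ℝ (fun z => α z - β z) z v w) =ᶠ[nhds y]
        fun z => fderiv ℝ α z v w - fderiv ℝ β z v w := by
      filter_upwards [hα.eventually (by simp), hβ.eventually (by simp)] with z h h'
      rw [fderiv_fun_sub (h.differentiableAt (by norm_num)) (h'.differentiableAt (by norm_num))]
      rfl
    exact congrArg (fun A => A u) <|
      (hasFDerivAt_fderiv_apply_apply (hα.sub hβ) v w).unique <|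
      ((hasFDerivAt_fderiv_apply_apply hα v w).fun_sub
        (hasFDerivAt_fderiv_apply_apply hβ v w)).congr_of_eventuallyEq h1
  rw [ContinuousAlternatingMap.sub_apply, S.ambientBox_apply hα, S.ambientBox_apply hβ,
    S.ambientBox_apply (hα.sub hβ), ← Finset.sum_sub_distrib]
  exact Finset.sum_congr rfl fun A _ => h _ _

theorem ambientBox_fun_const_smul
    {α : (Fin (n + 1) → ℝ) → (Fin (n + 1) → ℝ) [⋀^Fin 1]→L[ℝ] ℝ}
    {y : Fin (n + 1) → ℝ} (hα : ContDiffAt ℝ 2 α y) (r : ℝ) :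
    S.ambientBox (fun z => r • α z) y = r • S.ambientBox α y := by
  ext w
  have h : ∀ u v, fderiv ℝ (fderiv ℝ fun z => r • α z) y u v w =
      r * fderiv ℝ (fderiv ℝ α) y u v w := by
    intro u v
    have h1 : (fun z => fderiv ℝ (fun z => r • α z) z v w) =ᶠ[nhds y]
        fun z => r * fderiv ℝ α z v w := by
      filter_upwards [hα.eventually (by simp)] with z h
      rw [fderiv_fun_const_smul (h.differentiableAt (by norm_num))]
      rfl
    exact congrArg (fun A => A u) <|
      (hasFDerivAt_fderiv_apply_apply (hα.const_smul r) v w).unique <|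
      ((hasFDerivAt_fderiv_apply_apply hα v w).const_mul r).congr_of_eventuallyEq h1
  rw [ContinuousAlternatingMap.smul_apply, S.ambientBox_apply hα,
    S.ambientBox_apply (hα.const_smul r), smul_eq_mul, Finset.mul_sum]
  exact Finset.sum_congr rfl fun A _ => h _ _

/-! ## The Laplace-de Rham operator on homogeneous transverse extensions -/

theorem sum_σ_mul_η_smul_basisFun (v : Fin (n + 1) → ℝ) :
    ∑ A, (S.σ A * S.η v (Pi.basisFun ℝ _ A)) • Pi.basisFun ℝ (Fin (n + 1)) A = v := by
  have h := sum_apply_dualVec_smul S.η S.η_comm (Pi.basisFun ℝ _) S.gram_basisFun_det_ne_zero v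
  simpa only [dualVec_basisFun, map_smul, smul_eq_mul] using h

theorem sum_σ_mul_η_basisFun :
    ∑ A, S.σ A * S.η (Pi.basisFun ℝ _ A) (Pi.basisFun ℝ (Fin (n + 1)) A) = n + 1 := by
  have h : ∀ A, S.σ A * S.η (Pi.basisFun ℝ _ A) (Pi.basisFun ℝ (Fin (n + 1)) A) = 1 := by
    intro A
    rw [η_apply, Finset.sum_eq_single A (fun B _ hB => by simp [hB]) (by simp)]
    simp [S.σ_mul_self]
  rw [Finset.sum_congr rfl fun A _ => h A]
  simp

variable {S}

theorem IsSmooth.contDiffOn_ext {k : ℕ} {b : S.SphereForm k} (hb : S.IsSmooth b) (s : ℝ) :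
    ContDiffOn ℝ ∞ (S.ext s b) S.cone :=
  ((S.contDiffOn_radius_rpow s).smul hb).congr fun _ hy => S.ext_eq_rpow_smul s b hy

theorem IsSmooth.contDiffAt_ext_two {k : ℕ} {b : S.SphereForm k} (hb : S.IsSmooth b) (s : ℝ)
    {y : Fin (n + 1) → ℝ} (hy : y ∈ S.cone) : ContDiffAt ℝ 2 (S.ext s b) y :=
  ((hb.contDiffOn_ext s).contDiffAt (S.cone_mem_nhds hy)).of_le (WithTop.coe_le_coe.2 le_top)

/-- Leibniz rule, applied twice to $\rho^s b^{(0)}$ with $d(\rho^s)=-\epsilon H^2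
s\,\rho^{s-2}\eta(y,\cdot)$ and evaluated at $\rho=1$. -/
theorem IsSmooth.fderiv_fderiv_ext {b : S.SphereForm 1} (hb : S.IsSmooth b) (s : ℝ) (p : S.sphere)
    (u v : Fin (n + 1) → ℝ) (w : Fin 1 → Fin (n + 1) → ℝ) :
    fderiv ℝ (fderiv ℝ (S.ext s b)) p u v w =
      fderiv ℝ (fderiv ℝ (S.ext 0 b)) p u v w - S.ε * S.H ^ 2 * s *
        (S.η p u * fderiv ℝ (S.ext 0 b) p v w + S.η p v * fderiv ℝ (S.ext 0 b) p u w +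
          (S.η u v - S.ε * S.H ^ 2 * (s - 2) * S.η p u * S.η p v) * S.ext 0 b p w) := by
  have hp := S.sphere_subset_cone p
  have h1 : (fun z => fderiv ℝ (S.ext s b) z v w) =ᶠ[nhds (p : Fin (n + 1) → ℝ)] fun z =>
      S.radius z ^ s * fderiv ℝ (S.ext 0 b) z v w +
        -S.ε * S.H ^ 2 * s * S.radius z ^ (s - 2) * S.ηL z v * S.ext 0 b z w := by
    refine Filter.eventuallyEq_of_mem (S.cone_mem_nhds hp) fun z hz => ?_
    have h2 : S.ext s b =ᶠ[nhds z] fun z => S.radius z ^ s • S.ext 0 b z :=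
      Filter.eventuallyEq_of_mem (S.cone_mem_nhds hz) fun z hz => S.ext_eq_rpow_smul s b hz
    have h3 := ((S.hasFDerivAt_radius_rpow hz s).fun_smul
      (hb.differentiableAt hz).hasFDerivAt).fderiv
    change fderiv ℝ (S.ext s b) z v w = _
    rw [h2.fderiv_eq, h3]
    rfl
  have hw : HasFDerivAt (fun z => S.ext 0 b z w)
      ((ContinuousAlternatingMap.apply ℝ (Fin (n + 1) → ℝ) ℝ w).comp (fderiv ℝ (S.ext 0 b) p))
      (p : Fin (n + 1) → ℝ) :=
    (ContinuousAlternatingMap.apply ℝ (Fin (n + 1) → ℝ) ℝ w).hasFDerivAt.comp _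
      (hb.differentiableAt hp).hasFDerivAt
  have hη : HasFDerivAt (fun z => S.ηL z v) (S.ηL.flip v) (p : Fin (n + 1) → ℝ) :=
    (S.ηL.flip v).hasFDerivAt
  have h4 := ((S.hasFDerivAt_radius_rpow hp s).mul
    (hasFDerivAt_fderiv_apply_apply (hb.contDiffAt_two hp) v w)).add
    ((((S.hasFDerivAt_radius_rpow hp (s - 2)).const_mul (-S.ε * S.H ^ 2 * s)).mul hη).mul hw)
  have h5 := (hasFDerivAt_fderiv_apply_apply (hb.contDiffAt_ext_two s hp) v w).unique
    (h4.congr_of_eventuallyEq h1)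
  have h6 := congrArg (fun A => A u) h5
  simp only [Pi.mul_apply, S.radius_sphere, Real.one_rpow] at h6
  have h7 : fderiv ℝ (fderiv ℝ (S.ext s b)) p u v w =
      1 * fderiv ℝ (fderiv ℝ (S.ext 0 b)) p u v w + fderiv ℝ (S.ext 0 b) p v w *
        (-S.ε * S.H ^ 2 * s * 1 * S.η p u) +
      (-S.ε * S.H ^ 2 * s * 1 * S.η p v * fderiv ℝ (S.ext 0 b) p u w +
        S.ext 0 b p w * (-S.ε * S.H ^ 2 * s * 1 * S.η u v + S.η p v *
          (-S.ε * S.H ^ 2 * s * (-S.ε * S.H ^ 2 * (s - 2) * 1 * S.η p u)))) := h6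
  rw [h7]
  ring

/-- In the trace of the second derivative, Euler's relation turns the two cross terms into $-2$, the
trace of $\eta$ gives $n+1$, and $\epsilon H^2\eta(p,p)=-1$ gives $s-2$. Together
$s\,(n+1-2+s-2)=s^2+(n-3)s$. -/
theorem IsSmooth.ambientBox_ext {b : S.SphereForm 1} (hb : S.IsSmooth b) (s : ℝ) (p : S.sphere)
    (w : Fin 1 → Fin (n + 1) → ℝ) :
    S.ambientBox (S.ext s b) p w = S.ambientBox (S.ext 0 b) p w -
      S.ε * S.H ^ 2 * (s ^ 2 + ((n : ℝ) - 3) * s) * S.ext 0 b p w := by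
  have hp := S.sphere_subset_cone p
  have hH := S.H_pos.ne'
  set e := Pi.basisFun ℝ (Fin (n + 1)) with he
  set D := fderiv ℝ (S.ext 0 b) (p : Fin (n + 1) → ℝ) with hD
  have h1 : ∑ A, S.σ A * S.η p (e A) * D (e A) w = -S.ext 0 b p w := by
    have h := congrArg (fun u => D u w) (S.sum_σ_mul_η_smul_basisFun p)
    simp only [hD, hb.fderiv_ext_self hp] at h
    rw [← ContinuousAlternatingMap.neg_apply, ← h]
    simp [hD, he]
  have h2 : ∑ A, S.σ A * S.η p (e A) * S.η p (e A) = S.η p p := by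
    have h := congrArg (fun u => S.η p u) (S.sum_σ_mul_η_smul_basisFun p)
    simp only [map_sum, map_smul, smul_eq_mul] at h
    exact h
  have h3 := S.sum_σ_mul_η_basisFun
  rw [S.ambientBox_apply (hb.contDiffAt_ext_two s hp), S.ambientBox_apply (hb.contDiffAt_two hp)]
  have h4 : ∀ A, fderiv ℝ (fderiv ℝ (S.ext s b)) p (e A) (dualVec S.η e A) w =
      fderiv ℝ (fderiv ℝ (S.ext 0 b)) p (e A) (dualVec S.η e A) w -
      S.ε * S.H ^ 2 * s * (2 * (S.σ A * S.η p (e A) * D (e A) w) +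
        (S.σ A * S.η (e A) (e A) -
          S.ε * S.H ^ 2 * (s - 2) * (S.σ A * S.η p (e A) * S.η p (e A))) * S.ext 0 b p w) := by
    intro A
    rw [hb.fderiv_fderiv_ext, ← hD, he, S.dualVec_basisFun]
    simp only [map_smul, ContinuousAlternatingMap.smul_apply, smul_eq_mul]
    ring
  rw [Finset.sum_congr rfl fun A _ => h4 A, Finset.sum_sub_distrib, ← Finset.mul_sum,
    Finset.sum_add_distrib, ← Finset.mul_sum, h1, ← Finset.sum_mul, Finset.sum_sub_distrib,
    ← Finset.mul_sum, h2, h3, S.η_self_of_mem_sphere]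
  have h5 : S.ε * S.H ^ 2 * (s - 2) * (-S.ε * (S.H ^ 2)⁻¹) = -(s - 2) := by
    rw [show S.ε * S.H ^ 2 * (s - 2) * (-S.ε * (S.H ^ 2)⁻¹) =
      -(S.ε * S.ε) * (s - 2) * (S.H ^ 2 * (S.H ^ 2)⁻¹) by ring, S.ε_mul_self,
      mul_inv_cancel₀ (pow_ne_zero 2 hH)]
    ring
  rw [h5]
  ring

/-! ## The section -/

variable (S)

theorem ext_apply_coe {k : ℕ} (s : ℝ) (β : S.SphereForm k) (p : S.sphere)
    (w : Fin k → S.tangent p) : S.ext s β p (fun i => (w i : Fin (n + 1) → ℝ)) = β p w :=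
  congrArg (fun A : S.tangent p [⋀^Fin k]→L[ℝ] ℝ => A w) (congrFun (S.restr_ext s β) p)

theorem contDiffOn_varpi (s : ℝ) (χ : S.OneForm → S.OneForm) (b : S.OneForm) :
    ContDiffOn ℝ ∞ (S.varpi s χ b) S.cone :=
  ContDiffOn.sub b.2 ((((χ b).2.contDiffOn_ext s).sub (χ b).2).const_smul _)

theorem restr_varpi (s : ℝ) (χ : S.OneForm → S.OneForm) (b : S.OneForm) :
    S.restr (S.varpi s χ b) = b.1 := by
  funext p
  refine ContinuousAlternatingMap.ext fun w => ?_
  change S.ext 0 b.1 p (fun i => (w i : Fin (n + 1) → ℝ)) -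
    (S.ε * (S.H ^ 2)⁻¹) * (S.ext s (χ b).1 p (fun i => (w i : Fin (n + 1) → ℝ)) -
      S.ext 0 (χ b).1 p (fun i => (w i : Fin (n + 1) → ℝ))) = b.1 p w
  rw [ext_apply_coe, ext_apply_coe, ext_apply_coe, sub_self, mul_zero, sub_zero]

theorem additionalTerm_varpi {s : ℝ} (hs : s ^ 2 + ((n : ℝ) - 3) * s = 1)
    (χ : S.OneForm → S.OneForm) (b : S.OneForm) :
    S.additionalTerm (S.varpi s χ b) = (χ b).1 := by
  funext p
  refine ContinuousAlternatingMap.ext fun w => ?_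
  have hp := S.sphere_subset_cone p
  have hb := IsSmooth.contDiffAt_ext_two b.2 0 hp
  have h0 := IsSmooth.contDiffAt_ext_two (χ b).2 0 hp
  have h1 := IsSmooth.contDiffAt_ext_two (χ b).2 s hp
  have hbox : S.ambientBox (S.varpi s χ b) p = S.ambientBox (S.ext 0 b.1) p -
      (S.ε * (S.H ^ 2)⁻¹) • (S.ambientBox (S.ext s (χ b).1) p -
        S.ambientBox (S.ext 0 (χ b).1) p) := by
    rw [← S.ambientBox_fun_sub h1 h0, ← S.ambientBox_fun_const_smul (h1.sub h0),
      ← S.ambientBox_fun_sub hb ((h1.sub h0).const_smul _)]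
    rfl
  change S.ambientBox (S.varpi s χ b) p (fun i => (w i : Fin (n + 1) → ℝ)) -
    (S.sphereBox (S.restr (S.varpi s χ b)) p : S.tangent p [⋀^Fin 1]→L[ℝ] ℝ) w = (χ b).1 p w
  -- The correction restricts to zero, so the intrinsic operator sees only `b`, whose degree-zero
  -- extension has no additional term.
  have hsphere : (S.sphereBox (S.restr (S.varpi s χ b)) p : S.tangent p [⋀^Fin 1]→L[ℝ] ℝ) w =
      S.ambientBox (S.ext 0 b.1) p (fun i => (w i : Fin (n + 1) → ℝ)) := by
    rw [S.restr_varpi]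
    exact IsSmooth.sphereBox_apply b.2 p w
  rw [hsphere, hbox, ContinuousAlternatingMap.sub_apply, ContinuousAlternatingMap.smul_apply,
    ContinuousAlternatingMap.sub_apply, IsSmooth.ambientBox_ext (χ b).2, hs, ext_apply_coe,
    smul_eq_mul]
  have hH : S.H ^ 2 * (S.H ^ 2)⁻¹ = 1 := mul_inv_cancel₀ (pow_ne_zero 2 S.H_pos.ne')
  linear_combination (S.H ^ 2 * (S.H ^ 2)⁻¹ * (χ b).1 p w) * S.ε_mul_self + (χ b).1 p w * hH

end PseudoSphereData

end

/-! ### The main theorem -/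

theorem mainTheorem9 (n : ℕ) (S : PseudoSphereData n) (χ : S.OneForm → S.OneForm) :
    (∃ s : ℝ, s ^ 2 + ((n : ℝ) - 3) * s = 1) ∧
      ∀ s : ℝ, s ^ 2 + ((n : ℝ) - 3) * s = 1 →
        (∀ b : S.OneForm, ContDiffOn ℝ ∞ (S.varpi s χ b) S.cone) ∧
        (∀ b : S.OneForm, S.restr (S.varpi s χ b) = b.1) ∧
        (∀ b : S.OneForm, S.additionalTerm (S.varpi s χ b) = (χ b).1) := by
  -- The larger root of the quadratic, real because its discriminant $(n-3)^2+4$ is positive.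
  refine ⟨⟨(-((n : ℝ) - 3) + √(((n : ℝ) - 3) ^ 2 + 4)) / 2, ?_⟩, fun s hs =>
    ⟨S.contDiffOn_varpi s χ, S.restr_varpi s χ, S.additionalTerm_varpi hs χ⟩⟩
  have h : √(((n : ℝ) - 3) ^ 2 + 4) ^ 2 = ((n : ℝ) - 3) ^ 2 + 4 := Real.sq_sqrt (by positivity)
  linear_combination h / 4
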